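/- Let $N,N_{\rm c},T\ge 1$ be integers and $P_0,\sigma_{\rm c},\sigma_{\mathsf h}>0$. Consider the channel $\mathsf Y=\mathsf H\mathsf X+\mathsf Z$ over one coherence block of length $T$, where the input $\mathsf X$ is a random $N\times T$ complex matrix, the noise $\mathsf Z\in\mathbb C^{N_{\rm c}\times T}$ is independent of $(\mathsf H,\mathsf X)$ with i.i.d. $\mathcal{CN}(0,\sigma_{\rm c}^2)$ entries, and the channel matrix $\mathsf H\in\mathbb C^{N_{\rm c}\times N}$ has i.i.d. $\mathcal{CN}(0,\sigma_{\mathsf h}^2)$ entries and is known at the transmitter and at the communication receiver. For a realization $\mathsf H=H$, an input law is admissible if $\mathsf X$ has finite second moments and its correlation matrix $R_{\mathsf X}=\mathbb E[T^{-1}\mathsf X\mathsf X^\dagger]$ satisfies $\operatorname{Tr}R_{\mathsf X}\le NP_0$; its rate is $T^{-1}I(\mathsf X;\mathsf Y\mid\mathsf H=H)$. Logarithms are natural. (1) Let $H\neq 0$, $r_H=\operatorname{rank}H$. There are $N\times r_H$ matrices $U_H,V_H$ with orthonormal columns and $\Gamma_H=\operatorname{diag}(\gamma_1,\dots,\gamma_{r_H})$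 with $\gamma_i>0$ such that $H^\dagger H=U_H\Gamma_H V_H^\dagger$. For any such decomposition there is exactly one $\eta_{\rm c}\in\mathbb R$ with $\sum_{i=1}^{r_H}\left(\eta_{\rm c}-\sigma_{\rm c}^2/\gamma_i\right)^+=NP_0$. Put $P_{\rm c}=\operatorname{diag}\left[(\eta_{\rm c}-\sigma_{\rm c}^2/\gamma_i)^+\right]_{i=1}^{r_H}$ and $R_{\rm c}=V_HP_{\rm c}U_H^\dagger$, so that $\operatorname{Tr}R_{\rm c}=NP_0$. An admissible input law maximizes the rate over all admissible laws if and only if the columns of $\mathsf X$ are i.i.d. zero-mean circularly symmetric complex Gaussian with covariance matrix $R_{\rm c}$, equivalently if and only if it is the law of $\mathsf X_{\rm c}=V_HP_{\rm c}^{1/2}\mathsf N$, where $\mathsf N\in\mathbb C^{r_H\times T}$ has i.i.d. $\mathcal{CN}(0,1)$ entries. The correlation matrix of $\mathsf X_{\rm c}$ is $R_{\rm c}$ and its rate is $\sum_{i=1}^{r_H}\left[\log(\sigma_{\rm c}^{-2}\eta_{\rm c}\gamma_i)\right]^+$. (2) The maximal ergodic coherent rate $\mathcal R_{\rm c}=\sup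 T^{-1}I(\mathsf X;\mathsf Y\mid\mathsf H)=\sup T^{-1}\mathbb E_{\mathsf H}\left[I(\mathsf X;\mathsf Y\mid\mathsf H=H)\right]$, the supremum being over all conditional laws of $\mathsf X$ given $\mathsf H$ that are admissible for almost every realization of $\mathsf H$, is finite and equals $$\mathcal R_{\rm c}=\mathbb E_{\mathsf H}\left[\sum_{i=1}^{r_{\mathsf H}}\left[\log(\sigma_{\rm c}^{-2}\eta_{\rm c}\gamma_i)\right]^+\right],$$ where $r_{\mathsf H},\eta_{\rm c},\gamma_i$ depend on $\mathsf H$ as in (1). It is attained by a conditional law that is admissible for every realization and equals the law of $\mathsf X_{\rm c}$ whenever $H\ne0$. -/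

import Mathlib

open MeasureTheory ProbabilityTheory InformationTheory
open scoped ENNReal Matrix

noncomputable section

namespace MIMO

/-- Complex matrices carry the product (Borel) sigma-algebra of their entries. -/
instance instMeasurableSpaceMatrix {m n : Type*} : MeasurableSpace (Matrix m n ℂ) :=
  inferInstanceAs (MeasurableSpace (m → n → ℂ))

/-! ### Complex Gaussian laws -/

/-- The scalar circularly symmetric complex Gaussian law `CN(0, v)`: real and imaginary parts are
independent, centred, real Gaussian with variance `v / 2` each. -/
def complexGaussian (v : ℝ) : Measure ℂ :=
  ((gaussianReal 0 (v / 2).toNNReal).prod (gaussianReal 0 (v / 2).toNNReal)).map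
    (fun p => (⟨p.1, p.2⟩ : ℂ))

/-- The law of an `m × n` random matrix with i.i.d. `CN(0, v)` entries. -/
def gaussianMatrix (m n : ℕ) (v : ℝ) : Measure (Matrix (Fin m) (Fin n) ℂ) :=
  (Measure.pi fun _ : Fin m => Measure.pi fun _ : Fin n => complexGaussian v).map Matrix.of

/-- `μ` is the circularly symmetric complex Gaussian law `CN(0, R)` on `ℂⁿ`: it is (jointly)
Gaussian, possibly degenerate, with mean zero, covariance `E[x x†] = R` and vanishing
pseudo-covariance `E[x xᵀ] = 0`. -/
structure IsCircularGaussian {n : ℕ} (μ : Measure (Fin n → ℂ)) (R : Matrix (Fin n) (Fin n) ℂ) :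
    Prop where
  gaussian : IsGaussian μ
  mean : ∀ i, ∫ x, x i ∂μ = 0
  covariance : ∀ i k, ∫ x, x i * star (x k) ∂μ = R i k
  pseudoCovariance : ∀ i k, ∫ x, x i * x k ∂μ = 0

/-- The columns of a random `N × T` matrix with law `μ` are i.i.d. `CN(0, R)`. -/
structure HasIIDGaussianColumns {N T : ℕ} (μ : Measure (Matrix (Fin N) (Fin T) ℂ))
    (R : Matrix (Fin N) (Fin N) ℂ) : Prop where
  probability : IsProbabilityMeasure μ
  independent : iIndepFun (fun (t : Fin T) (X : Matrix (Fin N) (Fin T) ℂ) (i : Fin N) => X i t) μ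
  column : ∀ t : Fin T, IsCircularGaussian (μ.map fun X i => X i t) R

/-! ### Channel, mutual information and rate -/

/-- Mutual information (in nats) of a pair of random variables with joint law `ρ`: the
Kullback-Leibler divergence of `ρ` from the product of its marginals. -/
def mutualInfo {α β : Type*} [MeasurableSpace α] [MeasurableSpace β] (ρ : Measure (α × β)) :
    ℝ≥0∞ :=
  klDiv ρ (ρ.fst.prod ρ.snd)

/-- The joint law of input and output `(X, H X + Z)`, where `X` has law `μ` and the noise `Z`,
independent of `X`, has i.i.d. `CN(0, s)` entries. -/
def channelJoint {Nc N T : ℕ} (H : Matrix (Fin Nc) (Fin N) ℂ) (s : ℝ)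
    (μ : Measure (Matrix (Fin N) (Fin T) ℂ)) :
    Measure (Matrix (Fin N) (Fin T) ℂ × Matrix (Fin Nc) (Fin T) ℂ) :=
  (μ.prod (gaussianMatrix Nc T s)).map (fun p => (p.1, H * p.1 + p.2))

/-- The coherent rate `T⁻¹ I(X; Y | H = H)` of the input law `μ` for the channel realization `H`
and noise variance `s`. -/
def coherentRate {Nc N T : ℕ} (H : Matrix (Fin Nc) (Fin N) ℂ) (s : ℝ)
    (μ : Measure (Matrix (Fin N) (Fin T) ℂ)) : ℝ≥0∞ :=
  (T : ℝ≥0∞)⁻¹ * mutualInfo (channelJoint H s μ)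

/-- The statistical correlation matrix `R_X = E[T⁻¹ X X†]`. -/
def correlationMatrix {N T : ℕ} (μ : Measure (Matrix (Fin N) (Fin T) ℂ)) :
    Matrix (Fin N) (Fin N) ℂ :=
  Matrix.of fun i k => ∫ X, ((T : ℂ)⁻¹ • (X * Xᴴ)) i k ∂μ

/-- `μ` is an admissible input law for the total power budget `P`: a probability law with finite
second moments and `Tr R_X ≤ P`. -/
structure IsAdmissible {N T : ℕ} (P : ℝ) (μ : Measure (Matrix (Fin N) (Fin T) ℂ)) : Prop where
  probability : IsProbabilityMeasure μ
  secondMoment : ∀ i t, MemLp (fun X : Matrix (Fin N) (Fin T) ℂ => X i t) 2 μ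
  power : (correlationMatrix μ).trace.re ≤ P

/-- `μ` maximizes the coherent rate for the channel realization `H` among all admissible laws. -/
def IsRateMaximizer {Nc N T : ℕ} (H : Matrix (Fin Nc) (Fin N) ℂ) (s P : ℝ)
    (μ : Measure (Matrix (Fin N) (Fin T) ℂ)) : Prop :=
  IsAdmissible P μ ∧
    ∀ ν : Measure (Matrix (Fin N) (Fin T) ℂ), IsAdmissible P ν →
      coherentRate H s ν ≤ coherentRate H s μ

/-- The ergodic coherent rate `T⁻¹ I(X; Y | H) = T⁻¹ E_H[I(X; Y | H = H)]`, where the entries of `H`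
are i.i.d. `CN(0, h)` and `κ H` is the conditional law of the input given `H`, which the transmitter
knows. -/
def ergodicRate {Nc N T : ℕ} (h s : ℝ)
    (κ : Kernel (Matrix (Fin Nc) (Fin N) ℂ) (Matrix (Fin N) (Fin T) ℂ)) : ℝ≥0∞ :=
  ∫⁻ H, coherentRate H s (κ H) ∂(gaussianMatrix Nc N h)

/-- The maximal ergodic coherent rate: the supremum of the ergodic coherent rate over all
conditional input laws that satisfy the power constraint for almost every channel realization. -/
def maxErgodicRate (Nc N T : ℕ) (h s P : ℝ) : ℝ≥0∞ :=
  ⨆ (κ : Kernel (Matrix (Fin Nc) (Fin N) ℂ) (Matrix (Fin N) (Fin T) ℂ))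
    (_ : ∀ᵐ H ∂(gaussianMatrix Nc N h), IsAdmissible P (κ H)), ergodicRate h s κ

/-! ### Water-filling -/

/-- The reduced decomposition `H†H = U Γ V†` with `Γ = diag(γ)` positive of size `rank H`, and `U`, `V`
with orthonormal columns. -/
structure IsEigenmodeDecomposition {Nc N : ℕ} (H : Matrix (Fin Nc) (Fin N) ℂ)
    (U V : Matrix (Fin N) (Fin H.rank) ℂ) (γ : Fin H.rank → ℝ) : Prop where
  left : Uᴴ * U = 1
  right : Vᴴ * V = 1
  pos : ∀ i, 0 < γ i
  decomposition : Hᴴ * H = U * Matrix.diagonal (fun i => (γ i : ℂ)) * Vᴴ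

/-- The power `(η - s / γ)⁺` that water-filling at level `η` allocates to an eigenmode with gain
`γ`, for noise variance `s`. -/
def waterPower (s η γ : ℝ) : ℝ := max (η - s / γ) 0

/-- `η` is a water level for the gains `γ`: the allocated powers sum to `P`. -/
def IsWaterLevel {r : ℕ} (γ : Fin r → ℝ) (s P η : ℝ) : Prop :=
  ∑ i, waterPower s η (γ i) = P

/-- The rate `∑ᵢ [log (s⁻¹ η γᵢ)]⁺` (in nats). -/
def waterFillingRate {r : ℕ} (γ : Fin r → ℝ) (s η : ℝ) : ℝ :=
  ∑ i, max (Real.log (s⁻¹ * η * γ i)) 0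

/-- The covariance `V P U†`, with `P` the diagonal matrix of water-filling powers. -/
def waterFillingCovariance {N r : ℕ} (U V : Matrix (Fin N) (Fin r) ℂ) (γ : Fin r → ℝ)
    (s η : ℝ) : Matrix (Fin N) (Fin N) ℂ :=
  V * Matrix.diagonal (fun i => ((waterPower s η (γ i) : ℝ) : ℂ)) * Uᴴ

/-- The law of the waveform `X = V P^{1/2} W`, where the `r × T` matrix `W` has i.i.d. `CN(0, 1)`
entries and `P` is the diagonal matrix of water-filling powers. -/
def waterFillingLaw (T : ℕ) {N r : ℕ} (V : Matrix (Fin N) (Fin r) ℂ) (γ : Fin r → ℝ)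
    (s η : ℝ) : Measure (Matrix (Fin N) (Fin T) ℂ) :=
  (gaussianMatrix r T 1).map fun W =>
    V * Matrix.diagonal (fun i => ((Real.sqrt (waterPower s η (γ i)) : ℝ) : ℂ)) * W

end MIMO

end

open MIMO

/-! ### Complex Gaussian laws and characteristic functions of random matrices. -/

namespace MIMO

/-! Fix H ≠ 0, write s for the noise variance and pᵢ for the water-filling powers, and let K = s·1 +
H R_c H† be the covariance of an output column under the water-filling input. Take that Gaussian
output law as reference. By the compensation identity `mutualInfo_add_klDiv_snd`, I(X;Y) + D(P_Y ‖
reference) is the divergence of the joint law from P_X ⊗ reference. Since the noise is Gaussian,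
this divergence is a constant plus E tr(X†H†K⁻¹HX), hence a function of second moments only
(`mutualInfo_add_klDiv_coloredGaussian`). In the eigenmodes, H†K⁻¹H = U diag(γᵢ/(s+γᵢpᵢ)) U†
(`IsEigenmodeDecomposition.sum_weighted`), and water-filling is the statement that each weight is at
most 1/η, with equality where pᵢ > 0 (`weight_le`, `weight_mul_waterPower`): 1/η is the Lagrange
multiplier of the power constraint. The constants add up to T times the water-filling rate R, and if
nothing useful is discarded one gets I(X;Y) + D(P_Y ‖ reference) + η⁻¹ E‖X − UU†X‖² ≤ T R for every
admissible law (`IsEigenmodeDecomposition.mutualInfo_add_le`).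

Dropping the two slack terms gives optimality. If R is attained, both vanish: the output law is the
reference, so removing the noise through characteristic functions fixes the law of HX, and X = UU†X
almost surely. As H is injective on the range of U, the law of X is determined
(`IsEigenmodeDecomposition.eq_waterFillingLaw`).

For the ergodic rate the pointwise bound integrates. Attainment needs a measurable kernel, although
the decompositions may be chosen arbitrarily for each H. The positive semidefinite square root of
R_c does not depend on the choice: it is the unique maximizer of a jointly continuous function over
a compact set, hence continuous in H ≠ 0 (`measurable_optimalRoot`). -/

instance instBorelSpaceMatrix {m n : Type*} [Finite m] [Finite n] : BorelSpace (Matrix m n ℂ) :=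
  inferInstanceAs (BorelSpace (m → n → ℂ))

instance instSecondCountableTopologyMatrix {m n : Type*} [Finite m] [Finite n] :
    SecondCountableTopology (Matrix m n ℂ) :=
  inferInstanceAs (SecondCountableTopology (m → n → ℂ))

/-! ### Scalar complex Gaussian laws -/

lemma measurable_complex_mk : Measurable (fun p : ℝ × ℝ => (⟨p.1, p.2⟩ : ℂ)) :=
  Complex.measurableEquivRealProd.symm.measurable

instance isProbabilityMeasure_complexGaussian (v : ℝ) :
    IsProbabilityMeasure (complexGaussian v) :=
  Measure.isProbabilityMeasure_map measurable_complex_mk.aemeasurable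

instance isGaussian_complexGaussian (v : ℝ) : IsGaussian (complexGaussian v) :=
  isGaussian_map
    (μ := (gaussianReal 0 (v / 2).toNNReal).prod (gaussianReal 0 (v / 2).toNNReal))
    (Complex.equivRealProdCLM.symm : ℝ × ℝ →L[ℝ] ℂ)

/-- The characteristic function of `CN(0, v)`. -/
lemma integral_exp_complexGaussian {v : ℝ} (hv : 0 ≤ v) (ξ : ℂ) :
    ∫ z, Complex.exp (((star ξ * z).re : ℂ) * Complex.I) ∂complexGaussian v =
      Complex.exp (-(v * ‖ξ‖ ^ 2 / 4 : ℝ)) := by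
  rw [complexGaussian, integral_map measurable_complex_mk.aemeasurable (by fun_prop)]
  have h : ∀ p : ℝ × ℝ, Complex.exp (((star ξ * (⟨p.1, p.2⟩ : ℂ)).re : ℂ) * Complex.I) =
      Complex.exp (ξ.re * p.1 * Complex.I) * Complex.exp (ξ.im * p.2 * Complex.I) := by
    intro p
    rw [← Complex.exp_add]
    congr 1
    simp
    ring
  simp_rw [h]
  rw [integral_prod_mul (fun x : ℝ => Complex.exp (ξ.re * x * Complex.I))
    (fun x : ℝ => Complex.exp (ξ.im * x * Complex.I)), ← charFun_apply_real,
    ← charFun_apply_real, charFun_gaussianReal, charFun_gaussianReal, ← Complex.exp_add]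
  congr 1
  rw [← Complex.normSq_eq_norm_sq, Complex.normSq_apply, Real.coe_toNNReal _ (by positivity)]
  push_cast
  ring

lemma integrable_of_memLp_two {α : Type*} [MeasurableSpace α] {μ : Measure α} [IsFiniteMeasure μ]
    {f : α → ℂ} (hf : MemLp f 2 μ) : Integrable f μ := hf.integrable (by norm_num)

lemma memLp_complexGaussian (v : ℝ) : MemLp (fun z : ℂ => z) 2 (complexGaussian v) :=
  IsGaussian.memLp_id _ 2 (by norm_num)

lemma integral_complexGaussian (v : ℝ) : ∫ z, z ∂complexGaussian v = 0 := by
  have hi := integrable_of_memLp_two (memLp_complexGaussian v)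
  rw [complexGaussian, integral_map measurable_complex_mk.aemeasurable (by fun_prop)]
  have hr : Integrable (fun x : ℝ => x) (gaussianReal 0 (v / 2).toNNReal) :=
    (memLp_id_gaussianReal' 1 (by norm_num)).integrable le_rfl
  have h : ∀ p : ℝ × ℝ, (⟨p.1, p.2⟩ : ℂ) = (p.1 : ℂ) + (p.2 : ℂ) * Complex.I :=
    fun p => Complex.mk_eq_add_mul_I _ _
  simp_rw [h]
  rw [integral_add (hr.comp_fst _).ofReal ((hr.comp_snd _).ofReal.mul_const _), integral_mul_const,
    integral_complex_ofReal, integral_complex_ofReal, integral_fun_fst (fun x => x),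
    integral_fun_snd (fun x => x)]
  simp [integral_id_gaussianReal]

lemma integral_sq_gaussianReal (v : NNReal) : ∫ x, x ^ 2 ∂gaussianReal 0 v = v := by
  have h := variance_fun_id_gaussianReal (μ := 0) (v := v)
  rw [variance_eq_integral (by fun_prop), integral_id_gaussianReal] at h
  simpa using h

lemma integral_mul_self_complexGaussian (v : ℝ) : ∫ z, z * z ∂complexGaussian v = 0 := by
  rw [complexGaussian, integral_map measurable_complex_mk.aemeasurable (by fun_prop)]
  have hL : MemLp (fun x : ℝ => x) 2 (gaussianReal 0 (v / 2).toNNReal) :=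
    memLp_id_gaussianReal' 2 (by norm_num)
  have hr : Integrable (fun x : ℝ => x) (gaussianReal 0 (v / 2).toNNReal) :=
    hL.integrable (by norm_num)
  have hs : Integrable (fun x : ℝ => x ^ 2) (gaussianReal 0 (v / 2).toNNReal) := hL.integrable_sq
  have h : ∀ p : ℝ × ℝ, (⟨p.1, p.2⟩ : ℂ) * (⟨p.1, p.2⟩ : ℂ) =
      (((p.1 ^ 2 : ℝ) : ℂ) - ((p.2 ^ 2 : ℝ) : ℂ)) + ((p.1 * p.2 : ℝ) : ℂ) * (2 * Complex.I) := by
    intro p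
    apply Complex.ext
    · simp [sq]
    · simp [sq]
      ring
  have hm : Integrable (fun p : ℝ × ℝ => ((p.1 * p.2 : ℝ) : ℂ) * (2 * Complex.I))
      ((gaussianReal 0 (v / 2).toNNReal).prod (gaussianReal 0 (v / 2).toNNReal)) :=
    (hr.mul_prod hr).ofReal.mul_const _
  have hd : Integrable (fun p : ℝ × ℝ => ((p.1 ^ 2 : ℝ) : ℂ) - ((p.2 ^ 2 : ℝ) : ℂ))
      ((gaussianReal 0 (v / 2).toNNReal).prod (gaussianReal 0 (v / 2).toNNReal)) :=
    (hs.comp_fst _).ofReal.sub (hs.comp_snd _).ofReal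
  simp_rw [h]
  rw [integral_add hd hm,
    integral_sub (hs.comp_fst _).ofReal (hs.comp_snd _).ofReal, integral_mul_const,
    integral_complex_ofReal, integral_complex_ofReal, integral_complex_ofReal,
    integral_fun_fst (fun x => x ^ 2), integral_fun_snd (fun x => x ^ 2),
    integral_prod_mul (fun x => x) (fun x => x), integral_id_gaussianReal]
  simp

lemma integral_mul_star_complexGaussian {v : ℝ} (hv : 0 ≤ v) :
    ∫ z, z * star z ∂complexGaussian v = v := by
  rw [complexGaussian, integral_map measurable_complex_mk.aemeasurable (by fun_prop)]
  have hL : MemLp (fun x : ℝ => x) 2 (gaussianReal 0 (v / 2).toNNReal) :=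
    memLp_id_gaussianReal' 2 (by norm_num)
  have hs : Integrable (fun x : ℝ => x ^ 2) (gaussianReal 0 (v / 2).toNNReal) := hL.integrable_sq
  have h : ∀ p : ℝ × ℝ, (⟨p.1, p.2⟩ : ℂ) * star (⟨p.1, p.2⟩ : ℂ) =
      ((p.1 ^ 2 : ℝ) : ℂ) + ((p.2 ^ 2 : ℝ) : ℂ) := by
    intro p
    apply Complex.ext
    · simp [sq]
    · simp [sq]; ring
  simp_rw [h]
  rw [integral_add (hs.comp_fst _).ofReal (hs.comp_snd _).ofReal,
    integral_complex_ofReal, integral_complex_ofReal,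
    integral_fun_fst (fun x => x ^ 2), integral_fun_snd (fun x => x ^ 2), integral_sq_gaussianReal,
    Real.coe_toNNReal _ (by positivity)]
  simp

/-! ### The characteristic function of a random matrix -/

/-- The characteristic function `ξ ↦ E[exp(i Re tr(ξ† X))]` of a law of complex matrices. -/
noncomputable def matChar {m n : ℕ} (μ : Measure (Matrix (Fin m) (Fin n) ℂ))
    (ξ : Matrix (Fin m) (Fin n) ℂ) : ℂ :=
  ∫ X, Complex.exp (((ξᴴ * X).trace.re : ℂ) * Complex.I) ∂μ

lemma trace_conjTranspose_mul {m n : ℕ} (ξ X : Matrix (Fin m) (Fin n) ℂ) :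
    (ξᴴ * X).trace = ∑ i, ∑ t, star (ξ i t) * X i t := by
  rw [Finset.sum_comm]
  simp [Matrix.trace, Matrix.mul_apply]

lemma trace_conjTranspose_mul_self {m n : ℕ} (X : Matrix (Fin m) (Fin n) ℂ) :
    (Xᴴ * X).trace = ((∑ i, ∑ t, ‖X i t‖ ^ 2 : ℝ) : ℂ) := by
  rw [trace_conjTranspose_mul]
  push_cast
  refine Finset.sum_congr rfl fun i _ => Finset.sum_congr rfl fun t _ => ?_
  simpa using Complex.conj_mul' (X i t)

/-- Every real-linear functional on complex matrices has the form X ↦ Re tr(ξ†X), so `matChar` is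
the characteristic function on the real dual, reparametrized by ξ. -/
lemma ext_of_matChar {m n : ℕ} {μ ν : Measure (Matrix (Fin m) (Fin n) ℂ)} [IsFiniteMeasure μ]
    [IsFiniteMeasure ν] (h : ∀ ξ, matChar μ ξ = matChar ν ξ) : μ = ν := by
  have main : ∀ (μ ν : Measure (Fin m → Fin n → ℂ)) (_ : IsFiniteMeasure μ)
      (_ : IsFiniteMeasure ν), (∀ L : StrongDual ℝ (Fin m → Fin n → ℂ),
        ∫ X, Complex.exp (L X * Complex.I) ∂μ = ∫ X, Complex.exp (L X * Complex.I) ∂ν) → μ = ν :=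
    fun μ ν _ _ h => Measure.ext_of_charFunDual (funext fun L => by
      rw [charFunDual_apply, charFunDual_apply, h L])
  refine main μ ν ‹IsFiniteMeasure μ› ‹IsFiniteMeasure ν› fun L => ?_
  -- A real-linear functional ℓ on ℂ is z ↦ Re(w̄ z) with w = ℓ(1) + i ℓ(i); this is applied entry
  -- by entry.
  set ξ : Matrix (Fin m) (Fin n) ℂ := fun i t =>
    (⟨L (Pi.single i (Pi.single t 1)), L (Pi.single i (Pi.single t Complex.I))⟩ : ℂ) with hξ
  have key : ∀ X : Matrix (Fin m) (Fin n) ℂ, L X = (ξᴴ * X).trace.re := by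
    intro X
    have hX : X = ∑ i, ∑ t, ((X i t).re • (Pi.single i (Pi.single t 1) : Fin m → Fin n → ℂ) +
        (X i t).im • (Pi.single i (Pi.single t Complex.I) : Fin m → Fin n → ℂ)) := by
      ext i t
      simp only [Finset.sum_apply, Pi.add_apply, Pi.smul_apply]
      rw [Finset.sum_eq_single i (fun j _ hj => Finset.sum_eq_zero fun s _ => by
        rw [Pi.single_eq_of_ne hj.symm, Pi.single_eq_of_ne hj.symm]; simp) (by simp),
        Finset.sum_eq_single t (fun s _ hs => by
          rw [Pi.single_eq_same, Pi.single_eq_same, Pi.single_eq_of_ne hs.symm,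
            Pi.single_eq_of_ne hs.symm]; simp) (by simp)]
      simp
    rw [trace_conjTranspose_mul]
    conv_lhs => rw [hX]
    simp only [map_sum, map_add, map_smul, smul_eq_mul, Complex.re_sum]
    refine Finset.sum_congr rfl fun i _ => Finset.sum_congr rfl fun t _ => ?_
    simp [hξ]
    ring
  have := h ξ
  simp only [matChar, ← key] at this
  exact this

lemma measurable_mul_left {l m n : ℕ} (A : Matrix (Fin l) (Fin m) ℂ) :
    Measurable fun X : Matrix (Fin m) (Fin n) ℂ => A * X :=
  (continuous_const.matrix_mul continuous_id).measurable

lemma matChar_map_mul {l m n : ℕ} (μ : Measure (Matrix (Fin m) (Fin n) ℂ))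
    (A : Matrix (Fin l) (Fin m) ℂ) (ξ : Matrix (Fin l) (Fin n) ℂ) :
    matChar (μ.map (A * ·)) ξ = matChar μ (Aᴴ * ξ) := by
  unfold matChar
  rw [integral_map (measurable_mul_left A).aemeasurable]
  · simp [Matrix.mul_assoc]
  · exact Continuous.aestronglyMeasurable (by fun_prop)

lemma matChar_map_add {m n : ℕ} {α : Type*} [MeasurableSpace α] (μ : Measure α)
    (ν : Measure (Matrix (Fin m) (Fin n) ℂ)) [SFinite μ] [SFinite ν]
    {f : α → Matrix (Fin m) (Fin n) ℂ} (hf : Measurable f) (ξ : Matrix (Fin m) (Fin n) ℂ) :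
    matChar ((μ.prod ν).map fun p => f p.1 + p.2) ξ = matChar (μ.map f) ξ * matChar ν ξ := by
  unfold matChar
  have hc : Continuous fun X : Matrix (Fin m) (Fin n) ℂ =>
    Complex.exp (((ξᴴ * X).trace.re : ℂ) * Complex.I) := by fun_prop
  rw [integral_map (by fun_prop) hc.aestronglyMeasurable,
    integral_map hf.aemeasurable hc.aestronglyMeasurable, ← integral_prod_mul]
  congr 1
  ext p
  rw [← Complex.exp_add]
  simp [Matrix.mul_add, add_mul]

/-! ### Gaussian matrices with independent entries -/

/-- The law of a random matrix with independent entries, those in row `j` being `CN(0, k j)`. -/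
noncomputable def rowGaussian {m : ℕ} (n : ℕ) (k : Fin m → ℝ) : Measure (Matrix (Fin m) (Fin n) ℂ) :=
  Measure.pi fun j => Measure.pi fun _ : Fin n => complexGaussian (k j)

lemma gaussianMatrix_eq_rowGaussian (m n : ℕ) (v : ℝ) :
    gaussianMatrix m n v = rowGaussian n fun _ => v :=
  Measure.map_id

instance isProbabilityMeasure_rowGaussian {m : ℕ} (n : ℕ) (k : Fin m → ℝ) :
    IsProbabilityMeasure (rowGaussian n k) :=
  inferInstanceAs (IsProbabilityMeasure
    (Measure.pi fun j => Measure.pi fun _ : Fin n => complexGaussian (k j)))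

instance isProbabilityMeasure_gaussianMatrix (m n : ℕ) (v : ℝ) :
    IsProbabilityMeasure (gaussianMatrix m n v) := by
  rw [gaussianMatrix_eq_rowGaussian]
  infer_instance

lemma matChar_rowGaussian {m n : ℕ} {k : Fin m → ℝ} (hk : ∀ j, 0 ≤ k j)
    (ξ : Matrix (Fin m) (Fin n) ℂ) :
    matChar (rowGaussian n k) ξ =
      Complex.exp (-((∑ j, ∑ t, k j * ‖ξ j t‖ ^ 2) / 4 : ℝ)) := by
  have h : ∀ X : Fin m → Fin n → ℂ,
      Complex.exp (((ξᴴ * Matrix.of X).trace.re : ℂ) * Complex.I) =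
      ∏ j, ∏ t, Complex.exp (((star (ξ j t) * X j t).re : ℂ) * Complex.I) := by
    intro X
    simp_rw [trace_conjTranspose_mul, ← Complex.exp_sum, Complex.re_sum]
    push_cast
    simp_rw [Finset.sum_mul]
    rfl
  unfold matChar rowGaussian
  calc _ = ∫ X : Fin m → Fin n → ℂ,
        ∏ j, ∏ t, Complex.exp (((star (ξ j t) * X j t).re : ℂ) * Complex.I)
        ∂(Measure.pi fun j => Measure.pi fun _ : Fin n => complexGaussian (k j)) :=
        integral_congr_ae (Filter.Eventually.of_forall h)
    _ = _ := by
      rw [integral_fintype_prod_eq_prod (fun j (x : Fin n → ℂ) =>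
        ∏ t, Complex.exp (((star (ξ j t) * x t).re : ℂ) * Complex.I))]
      have : ∀ j, ∫ x : Fin n → ℂ, ∏ t, Complex.exp (((star (ξ j t) * x t).re : ℂ) * Complex.I)
          ∂(Measure.pi fun _ : Fin n => complexGaussian (k j)) =
          ∏ t, Complex.exp (-(k j * ‖ξ j t‖ ^ 2 / 4 : ℝ)) := by
        intro j
        rw [integral_fintype_prod_eq_prod (fun t (x : ℂ) =>
          Complex.exp (((star (ξ j t) * x).re : ℂ) * Complex.I))]
        exact Finset.prod_congr rfl fun t _ => integral_exp_complexGaussian (hk j) _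
      simp_rw [this, ← Complex.exp_sum]
      congr 1
      push_cast
      simp_rw [Finset.sum_div, Finset.sum_neg_distrib]

lemma matChar_gaussianMatrix {m n : ℕ} {v : ℝ} (hv : 0 ≤ v) (ξ : Matrix (Fin m) (Fin n) ℂ) :
    matChar (gaussianMatrix m n v) ξ = Complex.exp (-(v * (ξᴴ * ξ).trace / 4)) := by
  rw [gaussianMatrix_eq_rowGaussian, matChar_rowGaussian fun _ => hv, trace_conjTranspose_mul_self]
  simp_rw [← Finset.mul_sum]
  push_cast
  rfl

/-- The law of `A W` where `W` has i.i.d. `CN(0, 1)` entries. -/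
noncomputable def coloredGaussian {l m : ℕ} (n : ℕ) (A : Matrix (Fin l) (Fin m) ℂ) :
    Measure (Matrix (Fin l) (Fin n) ℂ) :=
  (gaussianMatrix m n 1).map (A * ·)

instance isProbabilityMeasure_coloredGaussian {l m n : ℕ} (A : Matrix (Fin l) (Fin m) ℂ) :
    IsProbabilityMeasure (coloredGaussian n A) :=
  Measure.isProbabilityMeasure_map (measurable_mul_left A).aemeasurable

lemma matChar_coloredGaussian {l m n : ℕ} (A : Matrix (Fin l) (Fin m) ℂ)
    (ξ : Matrix (Fin l) (Fin n) ℂ) :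
    matChar (coloredGaussian n A) ξ = Complex.exp (-((ξᴴ * (A * Aᴴ) * ξ).trace / 4)) := by
  rw [coloredGaussian, matChar_map_mul, matChar_gaussianMatrix zero_le_one]
  simp [Matrix.mul_assoc]

/-- Only `A * Aᴴ` enters the characteristic function. This later allows the N × rank H factor of the
covariance to be replaced by a square one. -/
lemma coloredGaussian_congr {l m m' n : ℕ} {A : Matrix (Fin l) (Fin m) ℂ}
    {A' : Matrix (Fin l) (Fin m') ℂ} (h : A * Aᴴ = A' * A'ᴴ) :
    coloredGaussian n A = coloredGaussian n A' :=
  ext_of_matChar fun ξ => by rw [matChar_coloredGaussian, matChar_coloredGaussian, h]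

lemma map_coloredGaussian {l m m' n : ℕ} (B : Matrix (Fin l) (Fin m) ℂ)
    (A : Matrix (Fin m) (Fin m') ℂ) :
    (coloredGaussian n A).map (B * ·) = coloredGaussian n (B * A) := by
  rw [coloredGaussian, coloredGaussian, Measure.map_map (measurable_mul_left B)
    (measurable_mul_left A)]
  congr 1
  ext1 X
  simp [Matrix.mul_assoc]

end MIMO

/-! ### Circular Gaussian vectors and matrices with i.i.d. Gaussian columns. -/

namespace MIMO

/-! ### Circularly symmetric Gaussian vectors -/

lemma integrable_mul_of_memLp_two {α : Type*} [MeasurableSpace α] {μ : Measure α}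
    {f g : α → ℂ} (hf : MemLp f 2 μ) (hg : MemLp g 2 μ) : Integrable (fun x => f x * g x) μ :=
  hf.integrable_mul hg

lemma IsCircularGaussian.memLp {n : ℕ} {μ : Measure (Fin n → ℂ)} {R : Matrix (Fin n) (Fin n) ℂ}
    (h : IsCircularGaussian μ R) (i : Fin n) : MemLp (fun x : Fin n → ℂ => x i) 2 μ := by
  have := h.gaussian
  exact (ContinuousLinearMap.proj (R := ℝ) (φ := fun _ : Fin n => ℂ) i).comp_memLp'
    (IsGaussian.memLp_id μ 2 (by norm_num))

lemma integral_sum_mul_sum {α ι κ : Type*} [MeasurableSpace α] [Fintype ι] [Fintype κ]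
    {μ : Measure α} {f : ι → α → ℂ} {g : κ → α → ℂ} (hf : ∀ i, MemLp (f i) 2 μ)
    (hg : ∀ k, MemLp (g k) 2 μ) (a : ι → ℂ) (b : κ → ℂ) :
    ∫ x, (∑ i, a i * f i x) * (∑ k, b k * g k x) ∂μ =
      ∑ i, ∑ k, a i * b k * ∫ x, f i x * g k x ∂μ := by
  have h : ∀ x, (∑ i, a i * f i x) * (∑ k, b k * g k x) =
      ∑ i, ∑ k, a i * b k * (f i x * g k x) := by
    intro x
    rw [Finset.sum_mul_sum]
    exact Finset.sum_congr rfl fun i _ => Finset.sum_congr rfl fun k _ => by ring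
  simp_rw [h]
  have hi : ∀ i k, Integrable (fun x => a i * b k * (f i x * g k x)) μ := fun i k =>
    (integrable_mul_of_memLp_two (hf i) (hg k)).const_mul _
  rw [integral_finsetSum _ fun i _ => integrable_finsetSum _ fun k _ => hi i k]
  refine Finset.sum_congr rfl fun i _ => ?_
  rw [integral_finsetSum _ fun k _ => hi i k]
  exact Finset.sum_congr rfl fun k _ => integral_const_mul _ _

/-- The characteristic function of `CN(0, R)`. -/
lemma IsCircularGaussian.integral_exp {n : ℕ} {μ : Measure (Fin n → ℂ)}
    {R : Matrix (Fin n) (Fin n) ℂ} (h : IsCircularGaussian μ R) (w : Fin n → ℂ) :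
    ∫ x, Complex.exp (((∑ i, star (w i) * x i).re : ℂ) * Complex.I) ∂μ =
      Complex.exp (-((∑ i, ∑ k, star (w i) * R i k * w k) / 4)) := by
  have := h.gaussian
  let L : StrongDual ℝ (Fin n → ℂ) := Complex.reCLM.comp
    (∑ i, (ContinuousLinearMap.mul ℝ ℂ (star (w i))).comp (ContinuousLinearMap.proj i))
  have hL : ∀ x : Fin n → ℂ, L x = (∑ i, star (w i) * x i).re := by
    intro x
    simp [L]
  set f : (Fin n → ℂ) → ℂ := fun x => ∑ i, star (w i) * x i with hf
  have hfm : MemLp f 2 μ := memLp_finsetSum _ fun i _ => (h.memLp i).const_mul _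
  have hfi : Integrable f μ := integrable_of_memLp_two hfm
  have hmean : ∫ x, f x ∂μ = 0 := by
    simp_rw [hf]
    rw [integral_finsetSum _ fun i _ => (integrable_of_memLp_two (h.memLp i)).const_mul _]
    simp [integral_const_mul, h.mean]
  have hstar : ∫ x, f x * star (f x) ∂μ = ∑ i, ∑ k, star (w i) * R i k * w k := by
    have : ∀ x, star (f x) = ∑ k, w k * star (x k) := fun x => by simp [hf]
    simp_rw [this, hf]
    rw [integral_sum_mul_sum (f := fun i (x : Fin n → ℂ) => x i)
      (g := fun k (x : Fin n → ℂ) => star (x k)) h.memLp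
      fun k => (h.memLp k).star]
    simp_rw [h.covariance]
    exact Finset.sum_congr rfl fun i _ => Finset.sum_congr rfl fun k _ => by ring
  have hself : ∫ x, f x * f x ∂μ = 0 := by
    simp_rw [hf]
    rw [integral_sum_mul_sum (f := fun i (x : Fin n → ℂ) => x i)
      (g := fun k (x : Fin n → ℂ) => x k) h.memLp h.memLp]
    simp [h.pseudoCovariance]
  have hnorm : ∫ x, f x * star (f x) ∂μ = ((∫ x, ‖f x‖ ^ 2 ∂μ : ℝ) : ℂ) := by
    rw [← integral_complex_ofReal]
    refine integral_congr_ae (Filter.Eventually.of_forall fun x => ?_)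
    simpa using Complex.mul_conj' (f x)
  have hLmean : μ[L] = 0 := by
    have : ∫ x, (f x).re ∂μ = (∫ x, f x ∂μ).re := integral_re hfi
    simp_rw [hL]
    rw [this, hmean]
    rfl
  have hLvar : Var[L; μ] = (∫ x, ‖f x‖ ^ 2 ∂μ) / 2 := by
    rw [variance_eq_integral (by fun_prop), hLmean]
    -- (Re f)² = |f|²/2 + Re(f²)/2; the last term integrates to zero because the pseudo-covariance
    -- vanishes, so circular symmetry makes the variance of `L` depend on R alone.
    have h2 : ∀ x, (L x - 0) ^ 2 = ‖f x‖ ^ 2 / 2 + (f x * f x).re / 2 := by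
      intro x
      rw [hL, ← Complex.normSq_eq_norm_sq, Complex.normSq_apply, Complex.mul_re]
      simp only [hf]
      ring
    simp_rw [h2]
    have h3 : ∫ x, (f x * f x).re ∂μ = (∫ x, f x * f x ∂μ).re :=
      integral_re (integrable_mul_of_memLp_two hfm hfm)
    rw [integral_add, integral_div, integral_div, h3, hself]
    · simp
    · exact (hfm.integrable_norm_pow (by norm_num)).div_const 2
    · exact (integrable_mul_of_memLp_two hfm hfm).re.div_const 2
  have := IsGaussian.charFunDual_eq (μ := μ) L
  rw [charFunDual_apply, integral_complex_ofReal, hLmean, hLvar] at this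
  simp_rw [hL] at this
  rw [this, ← hstar, hnorm]
  congr 1
  push_cast
  ring

lemma trace_conjTranspose_mul_mul {m n : ℕ} (ξ : Matrix (Fin m) (Fin n) ℂ)
    (R : Matrix (Fin m) (Fin m) ℂ) :
    (ξᴴ * R * ξ).trace = ∑ t, ∑ i, ∑ k, star (ξ i t) * R i k * ξ k t := by
  simp only [Matrix.trace, Matrix.diag, Matrix.mul_apply, Finset.sum_mul,
    Matrix.conjTranspose_apply]
  exact Finset.sum_congr rfl fun t _ => Finset.sum_comm

lemma measurable_entry {m n : ℕ} (i : Fin m) (t : Fin n) :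
    Measurable fun X : Matrix (Fin m) (Fin n) ℂ => X i t :=
  (continuous_id.matrix_elem i t).measurable

lemma measurable_column {m n : ℕ} (t : Fin n) :
    Measurable fun (X : Matrix (Fin m) (Fin n) ℂ) (i : Fin m) => X i t :=
  measurable_pi_lambda _ fun i => measurable_entry i t

lemma HasIIDGaussianColumns.matChar_eq {N T : ℕ} {μ : Measure (Matrix (Fin N) (Fin T) ℂ)}
    {R : Matrix (Fin N) (Fin N) ℂ} (h : HasIIDGaussianColumns μ R)
    (ξ : Matrix (Fin N) (Fin T) ℂ) :
    matChar μ ξ = Complex.exp (-((ξᴴ * R * ξ).trace / 4)) := by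
  have := h.probability
  have he : ∀ t, Continuous fun x : Fin N → ℂ =>
      Complex.exp (((∑ i, star (ξ i t) * x i).re : ℂ) * Complex.I) := fun t => by fun_prop
  have hX : ∀ X : Matrix (Fin N) (Fin T) ℂ,
      Complex.exp (((ξᴴ * X).trace.re : ℂ) * Complex.I) =
      ∏ t, Complex.exp (((∑ i, star (ξ i t) * X i t).re : ℂ) * Complex.I) := by
    intro X
    rw [trace_conjTranspose_mul, Finset.sum_comm, ← Complex.exp_sum, Complex.re_sum]
    push_cast
    rw [Finset.sum_mul]
  have hc : ∀ t, ∫ X, Complex.exp (((∑ i, star (ξ i t) * X i t).re : ℂ) * Complex.I) ∂μ =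
      Complex.exp (-((∑ i, ∑ k, star (ξ i t) * R i k * ξ k t) / 4)) := by
    intro t
    rw [← (h.column t).integral_exp fun i => ξ i t,
      integral_map (measurable_column t).aemeasurable (he t).aestronglyMeasurable]
  have hp : ∫ X, ∏ t, Complex.exp (((∑ i, star (ξ i t) * X i t).re : ℂ) * Complex.I) ∂μ =
      ∏ t, ∫ X, Complex.exp (((∑ i, star (ξ i t) * X i t).re : ℂ) * Complex.I) ∂μ :=
    iIndepFun.integral_fun_prod_comp (X := fun t (X : Matrix (Fin N) (Fin T) ℂ) i => X i t)
      (f := fun t (x : Fin N → ℂ) =>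
        Complex.exp (((∑ i, star (ξ i t) * x i).re : ℂ) * Complex.I))
      h.independent (fun t => (measurable_column t).aemeasurable)
      fun t => (he t).aestronglyMeasurable
  unfold matChar
  simp_rw [hX]
  rw [hp, Finset.prod_congr rfl fun t _ => hc t, ← Complex.exp_sum, trace_conjTranspose_mul_mul,
    Finset.sum_neg_distrib, Finset.sum_div]

/-- The characteristic function depends on R only. This links the two descriptions of the maximizer,
by its columns and as an explicit law. -/
lemma HasIIDGaussianColumns.ext {N T : ℕ} {μ ν : Measure (Matrix (Fin N) (Fin T) ℂ)}
    {R : Matrix (Fin N) (Fin N) ℂ} (h : HasIIDGaussianColumns μ R)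
    (h' : HasIIDGaussianColumns ν R) : μ = ν := by
  have := h.probability
  have := h'.probability
  exact ext_of_matChar fun ξ => by rw [h.matChar_eq, h'.matChar_eq]

lemma HasIIDGaussianColumns.memLp {N T : ℕ} {μ : Measure (Matrix (Fin N) (Fin T) ℂ)}
    {R : Matrix (Fin N) (Fin N) ℂ} (h : HasIIDGaussianColumns μ R) (i : Fin N) (t : Fin T) :
    MemLp (fun X : Matrix (Fin N) (Fin T) ℂ => X i t) 2 μ :=
  (memLp_map_measure_iff (measurable_pi_apply i).aestronglyMeasurable
    (measurable_column t).aemeasurable).1 ((h.column t).memLp i)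

lemma HasIIDGaussianColumns.integral_mul_star {N T : ℕ}
    {μ : Measure (Matrix (Fin N) (Fin T) ℂ)} {R : Matrix (Fin N) (Fin N) ℂ}
    (h : HasIIDGaussianColumns μ R) (i k : Fin N) (t : Fin T) :
    ∫ X, X i t * star (X k t) ∂μ = R i k := by
  rw [← (h.column t).covariance i k, integral_map (measurable_column t).aemeasurable]
  exact Continuous.aestronglyMeasurable (by fun_prop)

lemma correlationMatrix_apply {N T : ℕ} {μ : Measure (Matrix (Fin N) (Fin T) ℂ)}
    (h : ∀ i t, MemLp (fun X : Matrix (Fin N) (Fin T) ℂ => X i t) 2 μ) (i k : Fin N) :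
    correlationMatrix μ i k = (T : ℂ)⁻¹ * ∑ t, ∫ X, X i t * star (X k t) ∂μ := by
  simp only [correlationMatrix, Matrix.of_apply, Matrix.smul_apply, Matrix.mul_apply,
    Matrix.conjTranspose_apply, smul_eq_mul]
  rw [integral_const_mul, integral_finsetSum]
  exact fun t _ => integrable_mul_of_memLp_two (h i t) (h k t).star

lemma HasIIDGaussianColumns.correlationMatrix {N T : ℕ} (hT : 0 < T)
    {μ : Measure (Matrix (Fin N) (Fin T) ℂ)} {R : Matrix (Fin N) (Fin N) ℂ}
    (h : HasIIDGaussianColumns μ R) : correlationMatrix μ = R := by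
  ext i k
  rw [correlationMatrix_apply h.memLp]
  simp_rw [h.integral_mul_star]
  have : (T : ℂ) ≠ 0 := by exact_mod_cast hT.ne'
  simp [this]

/-! ### Gaussian matrices have Gaussian columns -/

lemma isCircularGaussian_pi (m : ℕ) :
    IsCircularGaussian (Measure.pi fun _ : Fin m => complexGaussian 1) 1 := by
  have hmap : ∀ i, (Measure.pi fun _ : Fin m => complexGaussian 1).map (fun x => x i) =
      complexGaussian 1 := fun i => (measurePreserving_eval _ i).map_eq
  have hind : iIndepFun (fun (i : Fin m) (x : Fin m → ℂ) => x i)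
      (Measure.pi fun _ : Fin m => complexGaussian 1) :=
    iIndepFun_pi (X := fun _ z => z) fun _ => aemeasurable_id
  have hint : ∀ i (g : ℂ → ℂ), Continuous g →
      ∫ x, g (x i) ∂(Measure.pi fun _ : Fin m => complexGaussian 1) =
      ∫ z, g z ∂complexGaussian 1 := by
    intro i g hg
    conv_rhs => rw [← hmap i]
    rw [integral_map (measurable_pi_apply i).aemeasurable hg.aestronglyMeasurable]
  have hprod : ∀ i k, i ≠ k → ∀ g : ℂ → ℂ, Continuous g →
      ∫ x, x i * g (x k) ∂(Measure.pi fun _ : Fin m => complexGaussian 1) = 0 := by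
    intro i k hik g hg
    rw [(hind.indepFun hik).integral_fun_comp_mul_comp (f := fun z => z) (g := g)
      (measurable_pi_apply i).aemeasurable (measurable_pi_apply k).aemeasurable
      aestronglyMeasurable_id hg.aestronglyMeasurable, hint i (fun z => z) continuous_id,
      integral_complexGaussian, zero_mul]
  refine ⟨?_, fun i => ?_, fun i k => ?_, fun i k => ?_⟩
  · have : HasGaussianLaw (fun (x : Fin m → ℂ) => fun i => x i)
        (Measure.pi fun _ : Fin m => complexGaussian 1) :=
      hind.hasGaussianLaw fun i => ⟨by rw [hmap i]; infer_instance⟩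
    simpa using this.isGaussian_map
  · exact (hint i (fun z => z) continuous_id).trans (integral_complexGaussian 1)
  · rcases eq_or_ne i k with rfl | hik
    · rw [hint i (fun z => z * star z) (by fun_prop),
        integral_mul_star_complexGaussian zero_le_one]
      simp
    · rw [hprod i k hik star continuous_star, Matrix.one_apply_ne hik]
  · rcases eq_or_ne i k with rfl | hik
    · rw [hint i (fun z => z * z) (by fun_prop), integral_mul_self_complexGaussian]
    · exact hprod i k hik (fun z => z) continuous_id

lemma IsCircularGaussian.map_mulVec {l m : ℕ} {μ : Measure (Fin m → ℂ)}
    {R : Matrix (Fin m) (Fin m) ℂ} (h : IsCircularGaussian μ R) (A : Matrix (Fin l) (Fin m) ℂ) :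
    IsCircularGaussian (μ.map (A *ᵥ ·)) (A * R * Aᴴ) := by
  have := h.gaussian
  have hc : Continuous fun x : Fin m → ℂ => A *ᵥ x := by fun_prop
  have hA : ∀ (x : Fin m → ℂ) i, (A *ᵥ x) i = ∑ j, A i j * x j := fun x i => rfl
  refine ⟨?_, fun i => ?_, fun i k => ?_, fun i k => ?_⟩
  · exact isGaussian_map (LinearMap.toContinuousLinearMap ((Matrix.mulVecLin A).restrictScalars ℝ))
  · rw [integral_map hc.aemeasurable (continuous_apply i).aestronglyMeasurable]
    simp_rw [hA]
    rw [integral_finsetSum _ fun j _ => (integrable_of_memLp_two (h.memLp j)).const_mul _]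
    simp [integral_const_mul, h.mean]
  · rw [integral_map hc.aemeasurable (by fun_prop)]
    have hs : ∀ (x : Fin m → ℂ), star ((A *ᵥ x) k) = ∑ j, star (A k j) * star (x j) :=
      fun x => by simp [hA]
    simp_rw [hs, hA]
    rw [integral_sum_mul_sum (f := fun j (x : Fin m → ℂ) => x j)
      (g := fun j (x : Fin m → ℂ) => star (x j)) h.memLp
      fun j => (h.memLp j).star]
    simp_rw [h.covariance, Matrix.mul_apply, Finset.sum_mul, Matrix.conjTranspose_apply]
    rw [Finset.sum_comm]
    exact Finset.sum_congr rfl fun i _ => Finset.sum_congr rfl fun k _ => by ring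
  · rw [integral_map hc.aemeasurable (by fun_prop)]
    simp_rw [hA]
    rw [integral_sum_mul_sum (f := fun j (x : Fin m → ℂ) => x j)
      (g := fun j (x : Fin m → ℂ) => x j) h.memLp h.memLp]
    simp [h.pseudoCovariance]

lemma measurable_transpose {m n : ℕ} :
    Measurable fun X : Matrix (Fin m) (Fin n) ℂ => Xᵀ :=
  (continuous_id.matrix_transpose).measurable

/-- `gaussianMatrix` is a product over rows, whereas independence of columns is wanted; the
quadratic form tr(ξ†ξ) is invariant under transposition. -/
lemma map_transpose_gaussianMatrix (m n : ℕ) {v : ℝ} (hv : 0 ≤ v) :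
    (gaussianMatrix m n v).map (fun X => Xᵀ) = gaussianMatrix n m v := by
  have := Measure.isProbabilityMeasure_map (μ := gaussianMatrix m n v)
    (measurable_transpose (m := m) (n := n)).aemeasurable
  refine ext_of_matChar fun ξ => ?_
  have h : ∀ (ξ : Matrix (Fin n) (Fin m) ℂ) (X : Matrix (Fin m) (Fin n) ℂ),
      (ξᴴ * Xᵀ).trace = ((ξᵀ)ᴴ * X).trace := by
    intro ξ X
    rw [trace_conjTranspose_mul, trace_conjTranspose_mul, Finset.sum_comm]
    rfl
  have hc : Continuous fun X : Matrix (Fin n) (Fin m) ℂ =>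
    Complex.exp (((ξᴴ * X).trace.re : ℂ) * Complex.I) := by fun_prop
  have h1 : matChar ((gaussianMatrix m n v).map (fun X => Xᵀ)) ξ =
      matChar (gaussianMatrix m n v) ξᵀ := by
    unfold matChar
    rw [integral_map measurable_transpose.aemeasurable hc.aestronglyMeasurable]
    simp_rw [h]
  rw [h1, matChar_gaussianMatrix hv, matChar_gaussianMatrix hv, ← h, Matrix.transpose_transpose]

/-- After transposition the columns of W are the coordinates of a product measure, and the columns
of `A * W` are their images under one and the same linear map. -/
lemma hasIIDGaussianColumns_coloredGaussian {l m : ℕ} (n : ℕ) (A : Matrix (Fin l) (Fin m) ℂ) :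
    HasIIDGaussianColumns (coloredGaussian n A) (A * Aᴴ) := by
  let G : Measure (Fin n → Fin m → ℂ) :=
    Measure.pi fun _ => Measure.pi fun _ => complexGaussian 1
  have hg : Measurable fun Y : Fin n → Fin m → ℂ => A * (Matrix.of Y)ᵀ :=
    (measurable_mul_left A).comp measurable_transpose
  have hlaw : coloredGaussian n A = G.map fun Y => A * (Matrix.of Y)ᵀ := by
    rw [coloredGaussian, ← map_transpose_gaussianMatrix n m zero_le_one,
      Measure.map_map (measurable_mul_left A) measurable_transpose, gaussianMatrix,
      Measure.map_map ((measurable_mul_left A).comp measurable_transpose)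
        (show Measurable Matrix.of from measurable_id)]
    rfl
  have hAm : Measurable fun x : Fin m → ℂ => A *ᵥ x :=
    Continuous.measurable (by fun_prop)
  have hind : iIndepFun (fun (t : Fin n) (Y : Fin n → Fin m → ℂ) => A *ᵥ Y t) G :=
    iIndepFun_pi (X := fun _ x => A *ᵥ x) fun _ => hAm.aemeasurable
  have hcol : ∀ t, (coloredGaussian n A).map (fun X i => X i t) =
      G.map fun Y => A *ᵥ Y t := by
    intro t
    rw [hlaw, Measure.map_map (measurable_column t) hg]
    rfl
  refine ⟨inferInstance, ?_, fun t => ?_⟩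
  · rw [iIndepFun_iff_map_fun_eq_pi_map fun t => (measurable_column t).aemeasurable]
    simp_rw [hcol]
    have hm : G.map (fun Y t => A *ᵥ Y t) = Measure.pi fun t => G.map fun Y => A *ᵥ Y t :=
      hind.map_fun_eq_pi_map fun t => (hAm.comp (measurable_pi_apply t)).aemeasurable
    rw [← hm, hlaw,
      Measure.map_map (measurable_pi_lambda _ fun t => measurable_column t) hg]
    rfl
  · have : (coloredGaussian n A).map (fun X i => X i t) =
        (Measure.pi fun _ : Fin m => complexGaussian 1).map (A *ᵥ ·) := by
      rw [hcol, ← (measurePreserving_eval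
        (fun _ : Fin n => Measure.pi fun _ : Fin m => complexGaussian 1) t).map_eq,
        Measure.map_map hAm (measurable_pi_apply t)]
      rfl
    rw [this]
    simpa using (isCircularGaussian_pi m).map_mulVec A

end MIMO

/-! ### Relative entropy and explicit Gaussian densities. -/

namespace MIMO

/-! ### Relative entropy -/

/-- Data processing for the map and for its inverse. -/
lemma klDiv_map_measurableEquiv {α β : Type*} [MeasurableSpace α] [MeasurableSpace β]
    (e : α ≃ᵐ β) (μ ν : Measure α) [IsFiniteMeasure μ] [IsFiniteMeasure ν] :
    klDiv (μ.map e) (ν.map e) = klDiv μ ν := by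
  refine le_antisymm (klDiv_map_le _ _ e.measurable) ?_
  have := klDiv_map_le (μ.map e) (ν.map e) e.symm.measurable
  rwa [Measure.map_map e.symm.measurable e.measurable,
    Measure.map_map e.symm.measurable e.measurable, e.symm_comp_self, Measure.map_id,
    Measure.map_id] at this

/-- The log-likelihood ratio is `f`, and the mass correction in `klDiv` cancels between two
probability measures. -/
lemma klDiv_withDensity_exp {α : Type*} [MeasurableSpace α] {μ ν : Measure α}
    [IsProbabilityMeasure μ] [IsProbabilityMeasure ν] {f : α → ℝ} (hf : Measurable f)
    (h : μ = ν.withDensity fun x => ENNReal.ofReal (Real.exp (f x))) (hi : Integrable f μ) :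
    klDiv μ ν = ENNReal.ofReal (∫ x, f x ∂μ) := by
  have hac : μ ≪ ν := h ▸ withDensity_absolutelyContinuous _ _
  have hm : Measurable fun x => ENNReal.ofReal (Real.exp (f x)) := by fun_prop
  have hl : llr μ ν =ᵐ[μ] f := by
    refine hac.ae_le ?_
    have := Measure.rnDeriv_withDensity ν hm
    rw [← h] at this
    filter_upwards [this] with x hx
    rw [llr, hx, ENNReal.toReal_ofReal (Real.exp_pos _).le, Real.log_exp]
  rw [klDiv_of_ac_of_integrable hac (hi.congr hl.symm), integral_congr_ae hl]
  simp

/-- The compensation identity: the relative entropy to a product with the right first marginal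
exceeds the mutual information by the relative entropy of the second marginals. -/
lemma mutualInfo_add_klDiv_snd {α β : Type*} [MeasurableSpace α] [StandardBorelSpace α] [Nonempty α]
    [MeasurableSpace β] (ρ : Measure (α × β)) [IsProbabilityMeasure ρ] (Q : Measure β)
    [IsProbabilityMeasure Q] :
    mutualInfo ρ + klDiv ρ.snd Q = klDiv ρ (ρ.fst.prod Q) := by
  -- The chain rule for `klDiv` splits off the first coordinate, so the pair is swapped to put β
  -- first. The conditional part then compares the law of α given β with the constant kernel
  -- `ρ.fst`; it does not involve `Q`, and for `Q = ρ.snd` it is all that remains.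
  have hswap : ∀ Q : Measure β, IsProbabilityMeasure Q → klDiv ρ (ρ.fst.prod Q) =
      klDiv (ρ.map Prod.swap) (Q.prod ρ.fst) := by
    intro Q _
    rw [← Measure.prod_swap (μ := ρ.fst) (ν := Q)]
    exact (klDiv_map_measurableEquiv MeasurableEquiv.prodComm ρ (ρ.fst.prod Q)).symm
  have : IsProbabilityMeasure (ρ.map Prod.swap) :=
    Measure.isProbabilityMeasure_map measurable_swap.aemeasurable
  have hρ : ρ.map Prod.swap = ρ.snd ⊗ₘ (ρ.map Prod.swap).condKernel := by
    conv_lhs => rw [← (ρ.map Prod.swap).disintegrate (ρ.map Prod.swap).condKernel]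
    rw [Measure.fst_map_swap]
  rw [mutualInfo, hswap Q inferInstance, hswap ρ.snd inferInstance, hρ, ← Measure.compProd_const,
    ← Measure.compProd_const, klDiv_compProd_eq_add ρ.snd Q, add_comm]

/-! ### Densities of shifted Gaussian matrices -/

/-- On a box both the indicator and the density are products of functions of single coordinates, so
the integral factors. -/
lemma pi_withDensity {ι : Type*} [Fintype ι] {α : ι → Type*} [∀ i, MeasurableSpace (α i)]
    (ν : ∀ i, Measure (α i)) [∀ i, IsProbabilityMeasure (ν i)] {f : ∀ i, α i → ℝ≥0∞}
    (hf : ∀ i, Measurable (f i)) [∀ i, SigmaFinite ((ν i).withDensity (f i))] :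
    Measure.pi (fun i => (ν i).withDensity (f i)) =
      (Measure.pi ν).withDensity fun x => ∏ i, f i (x i) := by
  refine Measure.pi_eq fun s hs => ?_
  rw [withDensity_apply _ (MeasurableSet.univ_pi hs),
    ← lintegral_indicator (MeasurableSet.univ_pi hs)]
  have h : ∀ x, (Set.univ.pi s).indicator (fun x => ∏ i, f i (x i)) x =
      ∏ i, (s i).indicator (f i) (x i) := by
    classical
    intro x
    by_cases hx : ∀ i, x i ∈ s i
    · rw [Set.indicator_of_mem (by simpa using hx)]
      exact Finset.prod_congr rfl fun i _ => (Set.indicator_of_mem (hx i) _).symm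
    · rw [Set.indicator_of_notMem (by simpa using hx)]
      push Not at hx
      obtain ⟨i, hi⟩ := hx
      exact (Finset.prod_eq_zero (Finset.mem_univ i) (Set.indicator_of_notMem hi _)).symm
  have hm : ∀ i, Measurable ((s i).indicator (f i)) := fun i => (hf i).indicator (hs i)
  simp_rw [h]
  rw [lintegral_prod_eq_prod_lintegral_of_indepFun Finset.univ
    (fun i (x : ∀ i, α i) => (s i).indicator (f i) (x i))
    (iIndepFun_pi fun i => (hm i).aemeasurable)
    fun i => (hm i).comp (measurable_pi_apply i)]
  refine Finset.prod_congr rfl fun i _ => ?_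
  rw [withDensity_apply _ (hs i), ← lintegral_indicator (hs i),
    ← (measurePreserving_eval ν i).lintegral_comp (hm i)]

/-- The logarithmic term is the ratio of the two normalizing constants. The reference is a centred
Gaussian rather than Lebesgue measure because divergences from Gaussian outputs are computed with
it. -/
lemma gaussianReal_eq_withDensity {v w : NNReal} (hv : v ≠ 0) (hw : w ≠ 0) (m : ℝ) :
    gaussianReal m v = (gaussianReal 0 w).withDensity fun x => ENNReal.ofReal
      (Real.exp (Real.log (w / v) / 2 - (x - m) ^ 2 / (2 * v) + x ^ 2 / (2 * w))) := by
  have hv' : (0 : ℝ) < v := by positivity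
  have hw' : (0 : ℝ) < w := by positivity
  rw [gaussianReal_of_var_ne_zero _ hv, gaussianReal_of_var_ne_zero _ hw,
    ← withDensity_mul _ (measurable_gaussianPDF _ _) (by fun_prop)]
  congr 1
  ext1 x
  rw [Pi.mul_apply, gaussianPDF, gaussianPDF, ← ENNReal.ofReal_mul (gaussianPDFReal_nonneg _ _ _)]
  congr 1
  have h1 : Real.exp (Real.log (w / v) / 2 - (x - m) ^ 2 / (2 * v) + x ^ 2 / (2 * w)) =
      √w / √v * Real.exp (-(x - m) ^ 2 / (2 * v)) * Real.exp (x ^ 2 / (2 * w)) := by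
    rw [← Real.sqrt_div hw'.le, ← Real.exp_log (Real.sqrt_pos.2 (div_pos hw' hv')),
      Real.log_sqrt (by positivity), ← Real.exp_add, ← Real.exp_add]
    ring_nf
  have h2 : Real.exp (-(x - 0) ^ 2 / (2 * w)) * Real.exp (x ^ 2 / (2 * w)) = 1 := by
    rw [← Real.exp_add, sub_zero, ← add_div, neg_add_cancel, zero_div, Real.exp_zero]
  have hsw : √(w : ℝ) ≠ 0 := (Real.sqrt_pos.2 hw').ne'
  have h3 : (√(2 * Real.pi * v))⁻¹ = (√(2 * Real.pi * w))⁻¹ * (√w / √v) := by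
    rw [Real.sqrt_mul (by positivity), Real.sqrt_mul (by positivity) (w : ℝ)]
    field_simp
  rw [gaussianPDFReal, gaussianPDFReal, h1, h3]
  linear_combination (-(√(2 * Real.pi * w))⁻¹ * (√w / √v) * Real.exp (-(x - m) ^ 2 / (2 * v))) * h2

/-- The law `CN(m, s)` has this density with respect to `CN(0, k)`. -/
lemma map_add_complexGaussian {s k : ℝ} (hs : 0 < s) (hk : 0 < k) (m : ℂ) :
    (complexGaussian s).map (m + ·) = (complexGaussian k).withDensity fun z => ENNReal.ofReal
      (Real.exp (Real.log (k / s) - ‖z - m‖ ^ 2 / s + ‖z‖ ^ 2 / k)) := by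
  have hv : (s / 2).toNNReal ≠ 0 := by simpa using hs
  have hw : (k / 2).toNNReal ≠ 0 := by simpa using hk
  have hv' : ((s / 2).toNNReal : ℝ) = s / 2 := Real.coe_toNNReal _ (by positivity)
  have hw' : ((k / 2).toNNReal : ℝ) = k / 2 := Real.coe_toNNReal _ (by positivity)
  set d : ℝ → ℝ → ℝ≥0∞ := fun a x => ENNReal.ofReal (Real.exp (Real.log (k / s) / 2 -
    (x - a) ^ 2 / s + x ^ 2 / k)) with hd
  have hg : ∀ a : ℝ, (gaussianReal 0 (s / 2).toNNReal).map (a + ·) =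
      (gaussianReal 0 (k / 2).toNNReal).withDensity (d a) := by
    intro a
    rw [gaussianReal_map_const_add, zero_add, gaussianReal_eq_withDensity hv hw, hv', hw']
    simp_rw [hd]
    congr! 7
    · field_simp
    · ring
    · ring
  have hdm : ∀ a, Measurable (d a) := fun a => by fun_prop
  have e : (complexGaussian s).map (m + ·) =
      (((gaussianReal 0 (s / 2).toNNReal).map (m.re + ·)).prod
        ((gaussianReal 0 (s / 2).toNNReal).map (m.im + ·))).map
          fun p : ℝ × ℝ => (⟨p.1, p.2⟩ : ℂ) := by
    rw [complexGaussian, Measure.map_map (by fun_prop) measurable_complex_mk,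
      Measure.map_prod_map _ _ (by fun_prop) (by fun_prop),
      Measure.map_map measurable_complex_mk (by fun_prop)]
    congr 1
  rw [e, hg, hg, prod_withDensity (hdm _) (hdm _), complexGaussian]
  ext S hS
  have hm : Measurable fun z : ℂ => ENNReal.ofReal
      (Real.exp (Real.log (k / s) - ‖z - m‖ ^ 2 / s + ‖z‖ ^ 2 / k)) := by fun_prop
  rw [Measure.map_apply measurable_complex_mk hS,
    withDensity_apply _ (measurable_complex_mk hS), withDensity_apply _ hS,
    setLIntegral_map hS hm measurable_complex_mk]
  refine lintegral_congr fun p => ?_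
  rw [hd, ← ENNReal.ofReal_mul (Real.exp_pos _).le, ← Real.exp_add, ← Complex.normSq_eq_norm_sq,
    ← Complex.normSq_eq_norm_sq, Complex.normSq_apply, Complex.normSq_apply]
  simp only [Complex.sub_re, Complex.sub_im]
  congr 2
  ring

/-- The log-likelihood ratio of a matrix with independent `CN(M j t, s)` entries with respect to
`rowGaussian k`. -/
noncomputable def gaussianLLR {m n : ℕ} (s : ℝ) (k : Fin m → ℝ) (M Y : Matrix (Fin m) (Fin n) ℂ) : ℝ :=
  ∑ j, ∑ t, (Real.log (k j / s) - ‖Y j t - M j t‖ ^ 2 / s + ‖Y j t‖ ^ 2 / k j)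

/-- The reference variance may differ from row to row: it will be the output law written in an
eigenbasis of its covariance. -/
lemma map_add_gaussianMatrix {m n : ℕ} {s : ℝ} (hs : 0 < s) {k : Fin m → ℝ} (hk : ∀ j, 0 < k j)
    (M : Matrix (Fin m) (Fin n) ℂ) :
    (gaussianMatrix m n s).map (M + ·) = (rowGaussian n k).withDensity fun Y =>
      ENNReal.ofReal (Real.exp (gaussianLLR s k M Y)) := by
  set d : Fin m → Fin n → ℂ → ℝ≥0∞ := fun j t z => ENNReal.ofReal
    (Real.exp (Real.log (k j / s) - ‖z - M j t‖ ^ 2 / s + ‖z‖ ^ 2 / k j)) with hd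
  have hdm : ∀ j t, Measurable (d j t) := fun j t => by fun_prop
  have hone : ∀ j t, (complexGaussian s).map (M j t + ·) =
    (complexGaussian (k j)).withDensity (d j t) := fun j t => map_add_complexGaussian hs (hk j) _
  have hp : ∀ j t, IsProbabilityMeasure ((complexGaussian (k j)).withDensity (d j t)) := by
    intro j t
    rw [← hone]
    exact Measure.isProbabilityMeasure_map (by fun_prop)
  have hrow : ∀ j, (Measure.pi fun _ : Fin n => complexGaussian s).map (fun x t => M j t + x t) =
      (Measure.pi fun _ : Fin n => complexGaussian (k j)).withDensity
        fun x => ∏ t, d j t (x t) := by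
    intro j
    rw [← pi_withDensity (fun _ : Fin n => complexGaussian (k j)) (hdm j)]
    simp_rw [← hone]
    exact Measure.pi_map_pi fun t => by fun_prop
  have hp' : ∀ j, IsProbabilityMeasure ((Measure.pi fun _ : Fin n => complexGaussian (k j)).withDensity
        fun x => ∏ t, d j t (x t)) := by
    intro j
    rw [← hrow]
    exact Measure.isProbabilityMeasure_map
      (Measurable.aemeasurable (measurable_pi_lambda _ fun t => by fun_prop))
  have hfull : (Measure.pi fun _ : Fin m => Measure.pi fun _ : Fin n => complexGaussian s).map
      (fun X j t => M j t + X j t) =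
      (Measure.pi fun j => Measure.pi fun _ : Fin n => complexGaussian (k j)).withDensity
        fun X => ∏ j, ∏ t, d j t (X j t) := by
    rw [← pi_withDensity (fun j => Measure.pi fun _ : Fin n => complexGaussian (k j))
      (f := fun j x => ∏ t, d j t (x t)) fun j => by fun_prop]
    simp_rw [← hrow]
    exact Measure.pi_map_pi (f := fun j (x : Fin n → ℂ) t => M j t + x t) fun j =>
      Measurable.aemeasurable (measurable_pi_lambda _ fun t => by fun_prop)
  have hprod : ∀ Y : Fin m → Fin n → ℂ, ENNReal.ofReal (Real.exp (gaussianLLR s k M Y)) =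
      ∏ j, ∏ t, d j t (Y j t) := by
    intro Y
    simp_rw [gaussianLLR, Real.exp_sum]
    rw [ENNReal.ofReal_prod_of_nonneg fun j _ => Finset.prod_nonneg fun t _ => (Real.exp_pos _).le]
    refine Finset.prod_congr rfl fun j _ => ?_
    rw [ENNReal.ofReal_prod_of_nonneg fun t _ => (Real.exp_pos _).le]
  rw [gaussianMatrix_eq_rowGaussian]
  refine hfull.trans ?_
  simp_rw [← hprod]
  rfl

end MIMO

/-! ### The channel output and the compensation identity for Gaussian noise. -/

namespace MIMO

instance instStandardBorelSpaceMatrix {m n : Type*} [Finite m] [Finite n] :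
    StandardBorelSpace (Matrix m n ℂ) :=
  inferInstanceAs (StandardBorelSpace (m → n → ℂ))

/-! ### Moments of the noise -/

lemma map_entry_gaussianMatrix {m n : ℕ} (v : ℝ) (j : Fin m) (t : Fin n) :
    (gaussianMatrix m n v).map (fun Z => Z j t) = complexGaussian v := by
  rw [gaussianMatrix_eq_rowGaussian]
  have h1 := (measurePreserving_eval (fun _ : Fin m =>
    Measure.pi fun _ : Fin n => complexGaussian v) j)
  have h2 := measurePreserving_eval (fun _ : Fin n => complexGaussian v) t
  exact (h2.comp h1).map_eq

lemma memLp_entry_gaussianMatrix {m n : ℕ} (v : ℝ) (j : Fin m) (t : Fin n) :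
    MemLp (fun Z : Matrix (Fin m) (Fin n) ℂ => Z j t) 2 (gaussianMatrix m n v) := by
  have h := memLp_complexGaussian v
  rw [← map_entry_gaussianMatrix (m := m) (n := n) v j t] at h
  exact (memLp_map_measure_iff aestronglyMeasurable_id (measurable_entry j t).aemeasurable).1 h

lemma integral_entry_gaussianMatrix {m n : ℕ} (v : ℝ) (j : Fin m) (t : Fin n) :
    ∫ Z, Z j t ∂gaussianMatrix m n v = 0 := by
  have h := integral_complexGaussian v
  rwa [← map_entry_gaussianMatrix (m := m) (n := n) v j t,
    integral_map (f := fun z : ℂ => z) (measurable_entry j t).aemeasurable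
      aestronglyMeasurable_id] at h

lemma integral_mul_star_self {α : Type*} [MeasurableSpace α] (μ : Measure α) (f : α → ℂ) :
    ∫ x, f x * star (f x) ∂μ = ((∫ x, ‖f x‖ ^ 2 ∂μ : ℝ) : ℂ) := by
  rw [← integral_complex_ofReal]
  refine integral_congr_ae (Filter.Eventually.of_forall fun x => ?_)
  simpa using Complex.mul_conj' (f x)

lemma integral_normSq_entry_gaussianMatrix {m n : ℕ} {v : ℝ} (hv : 0 ≤ v) (j : Fin m)
    (t : Fin n) : ∫ Z, ‖Z j t‖ ^ 2 ∂gaussianMatrix m n v = v := by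
  have h : ∫ z, ‖z‖ ^ 2 ∂complexGaussian v = v := by
    have := integral_mul_star_self (complexGaussian v) fun z => z
    rw [integral_mul_star_complexGaussian hv] at this
    exact_mod_cast this.symm
  rwa [← map_entry_gaussianMatrix (m := m) (n := n) v j t,
    integral_map (measurable_entry j t).aemeasurable (by fun_prop)] at h

lemma memLp_mul_entry {l m n : ℕ} {μ : Measure (Matrix (Fin m) (Fin n) ℂ)}
    (h : ∀ i t, MemLp (fun X : Matrix (Fin m) (Fin n) ℂ => X i t) 2 μ)
    (A : Matrix (Fin l) (Fin m) ℂ) (j : Fin l) (t : Fin n) :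
    MemLp (fun X : Matrix (Fin m) (Fin n) ℂ => (A * X) j t) 2 μ := by
  simp_rw [Matrix.mul_apply]
  exact memLp_finsetSum _ fun i _ => (h i t).const_mul _

/-! ### The joint law of input and output -/

section channelJoint

variable {Nc N T : ℕ} (H : Matrix (Fin Nc) (Fin N) ℂ) (s : ℝ)
  (μ : Measure (Matrix (Fin N) (Fin T) ℂ))

lemma measurable_channel :
    Measurable fun p : Matrix (Fin N) (Fin T) ℂ × Matrix (Fin Nc) (Fin T) ℂ =>
      (p.1, H * p.1 + p.2) :=
  measurable_fst.prodMk (((measurable_mul_left H).comp measurable_fst).add measurable_snd)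

lemma channelJoint_fst : (channelJoint H s μ).fst = μ := by
  rw [Measure.fst, channelJoint, Measure.map_map measurable_fst (measurable_channel H)]
  exact Measure.fst_prod

lemma channelJoint_snd : (channelJoint H s μ).snd =
    (μ.prod (gaussianMatrix Nc T s)).map
      fun p : Matrix (Fin N) (Fin T) ℂ × Matrix (Fin Nc) (Fin T) ℂ => H * p.1 + p.2 := by
  rw [Measure.snd, channelJoint, Measure.map_map measurable_snd (measurable_channel H)]
  rfl

variable {s} in
-- Fubini over the input: for fixed X the output is the noise shifted by `H * X`, whose density is
-- explicit. Nothing about the input law is needed.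
lemma channelJoint_eq_withDensity (hs : 0 < s) {k : Fin Nc → ℝ} (hk : ∀ j, 0 < k j) :
    channelJoint H s μ = (μ.prod (rowGaussian T k)).withDensity fun p =>
      ENNReal.ofReal (Real.exp (gaussianLLR s k (H * p.1) p.2)) := by
  have hm : Measurable fun p : Matrix (Fin N) (Fin T) ℂ × Matrix (Fin Nc) (Fin T) ℂ =>
      ENNReal.ofReal (Real.exp (gaussianLLR s k (H * p.1) p.2)) := by
    unfold gaussianLLR
    exact Measurable.ennreal_ofReal (Continuous.measurable (by fun_prop))
  ext S hS
  have hS' := measurable_channel H hS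
  rw [channelJoint, Measure.map_apply (measurable_channel H) hS, Measure.prod_apply hS',
    withDensity_apply _ hS, ← lintegral_indicator hS, lintegral_prod _ (hm.indicator hS).aemeasurable]
  refine lintegral_congr fun X => ?_
  have hSX : MeasurableSet (Prod.mk X ⁻¹' S) := measurable_prodMk_left hS
  have h := congrArg (fun ν => ν (Prod.mk X ⁻¹' S)) (map_add_gaussianMatrix (n := T) hs hk (H * X))
  beta_reduce at h
  rw [Measure.map_apply (measurable_const_add _) hSX, withDensity_apply _ hSX,
    ← lintegral_indicator hSX] at h
  exact h

variable [IsProbabilityMeasure μ]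

instance isProbabilityMeasure_channelJoint : IsProbabilityMeasure (channelJoint H s μ) :=
  Measure.isProbabilityMeasure_map (measurable_channel H).aemeasurable

variable {s} in
lemma matChar_channelJoint_snd (hs : 0 ≤ s) (ξ : Matrix (Fin Nc) (Fin T) ℂ) :
    matChar (channelJoint H s μ).snd ξ =
      matChar (μ.map (H * ·)) ξ * Complex.exp (-(s * (ξᴴ * ξ).trace / 4)) := by
  rw [channelJoint_snd, matChar_map_add _ _ (measurable_mul_left H), matChar_gaussianMatrix hs]

variable {s} in
/-- With i.i.d. noise, the law of the output determines that of the noiseless output. -/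
lemma map_mul_eq_of_snd_eq (hs : 0 ≤ s) (ν : Measure (Matrix (Fin N) (Fin T) ℂ))
    [IsProbabilityMeasure ν] (h : (channelJoint H s μ).snd = (channelJoint H s ν).snd) :
    μ.map (H * ·) = ν.map (H * ·) := by
  have := Measure.isProbabilityMeasure_map (μ := μ) (measurable_mul_left (n := T) H).aemeasurable
  have := Measure.isProbabilityMeasure_map (μ := ν) (measurable_mul_left (n := T) H).aemeasurable
  refine ext_of_matChar fun ξ => ?_
  have := congrArg (fun ρ => matChar ρ ξ) h
  simp only [matChar_channelJoint_snd _ _ hs] at this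
  -- The characteristic function of the noise vanishes nowhere, so convolution with it can be
  -- undone.
  exact mul_right_cancel₀ (Complex.exp_ne_zero _) this

variable {s} in
lemma channelJoint_coloredGaussian_snd {M : ℕ} (hs : 0 ≤ s) (A : Matrix (Fin N) (Fin M) ℂ)
    (ξ : Matrix (Fin Nc) (Fin T) ℂ) :
    matChar (channelJoint H s (coloredGaussian T A)).snd ξ =
      Complex.exp (-((ξᴴ * ((s : ℂ) • 1 + H * A * (H * A)ᴴ) * ξ).trace / 4)) := by
  rw [matChar_channelJoint_snd H _ hs, map_coloredGaussian, matChar_coloredGaussian,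
    ← Complex.exp_add]
  congr 1
  simp [Matrix.mul_add, Matrix.add_mul]
  ring

/-- Rotating the output is a bijection, and i.i.d. circular noise is invariant under it. One may
therefore work in a basis where the output covariance is diagonal. -/
lemma mutualInfo_channelJoint_unitary {B : Matrix (Fin Nc) (Fin Nc) ℂ} (hB : B * Bᴴ = 1)
    (hs : 0 ≤ s) : mutualInfo (channelJoint (B * H) s μ) = mutualInfo (channelJoint H s μ) := by
  have hB' : Bᴴ * B = 1 := mul_eq_one_comm.1 hB
  have hnoise : (gaussianMatrix Nc T s).map (B * ·) = gaussianMatrix Nc T s := by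
    have := Measure.isProbabilityMeasure_map (μ := gaussianMatrix Nc T s)
      (measurable_mul_left (n := T) B).aemeasurable
    refine ext_of_matChar fun ξ => ?_
    rw [matChar_map_mul, matChar_gaussianMatrix hs, matChar_gaussianMatrix hs,
      Matrix.conjTranspose_mul, Matrix.conjTranspose_conjTranspose, Matrix.mul_assoc,
      ← Matrix.mul_assoc B, hB, Matrix.one_mul]
  let e : Matrix (Fin Nc) (Fin T) ℂ ≃ᵐ Matrix (Fin Nc) (Fin T) ℂ :=
    { toFun := fun Y => B * Y
      invFun := fun Y => Bᴴ * Y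
      left_inv := fun Y => by simp [← Matrix.mul_assoc, hB']
      right_inv := fun Y => by simp [← Matrix.mul_assoc, hB]
      measurable_toFun := measurable_mul_left B
      measurable_invFun := measurable_mul_left Bᴴ }
  let e' := (MeasurableEquiv.refl (Matrix (Fin N) (Fin T) ℂ)).prodCongr e
  have hJ : channelJoint (B * H) s μ = (channelJoint H s μ).map e' := by
    have hn : μ.prod (gaussianMatrix Nc T s) =
        (μ.prod (gaussianMatrix Nc T s)).map (Prod.map id (B * ·)) := by
      rw [← Measure.map_prod_map _ _ measurable_id (measurable_mul_left B), hnoise, Measure.map_id]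
    conv_lhs => rw [channelJoint, hn]
    rw [channelJoint, Measure.map_map (measurable_channel _)
      (measurable_id.prodMap (measurable_mul_left B)), Measure.map_map e'.measurable
      (measurable_channel _)]
    congr 1
    ext1 p
    refine Prod.ext rfl ?_
    change B * H * p.1 + B * p.2 = B * (H * p.1 + p.2)
    rw [Matrix.mul_add, Matrix.mul_assoc]
  have hsnd : (channelJoint (B * H) s μ).snd = (channelJoint H s μ).snd.map e := by
    rw [hJ, Measure.snd, Measure.snd, Measure.map_map measurable_snd e'.measurable,
      Measure.map_map e.measurable measurable_snd]
    rfl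
  have hprod : (channelJoint (B * H) s μ).fst.prod (channelJoint (B * H) s μ).snd =
      ((channelJoint H s μ).fst.prod (channelJoint H s μ).snd).map e' := by
    rw [hsnd, channelJoint_fst, channelJoint_fst]
    have h := Measure.map_prod_map μ (channelJoint H s μ).snd measurable_id e.measurable
    rw [Measure.map_id] at h
    exact h
  rw [mutualInfo, hprod, hJ, klDiv_map_measurableEquiv, mutualInfo]

end channelJoint

/-! ### The compensation identity for Gaussian noise -/

section compensation

variable {Nc N T : ℕ} (H : Matrix (Fin Nc) (Fin N) ℂ) {s : ℝ}
  (μ : Measure (Matrix (Fin N) (Fin T) ℂ)) [IsProbabilityMeasure μ]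

/-- With Y = HX + Z, the residual Y − HX is the noise, giving −E|Z|²/s = −1. In E|Y|²/k the cross
term vanishes because Z is centred and independent of X, leaving s/k plus the signal power over k.
-/
lemma integral_gaussianLLR (hs : 0 < s) (k : Fin Nc → ℝ)
    (hμ : ∀ i t, MemLp (fun X : Matrix (Fin N) (Fin T) ℂ => X i t) 2 μ) :
    Integrable (fun p => gaussianLLR s k (H * p.1) p.2) (channelJoint H s μ) ∧
    ∫ p, gaussianLLR s k (H * p.1) p.2 ∂channelJoint H s μ =
      ∑ j, ∑ t, (Real.log (k j / s) - 1 + s / k j + (∫ X, ‖(H * X) j t‖ ^ 2 ∂μ) / k j) := by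
  set G := gaussianMatrix Nc T s
  have hc : Continuous fun p : Matrix (Fin N) (Fin T) ℂ × Matrix (Fin Nc) (Fin T) ℂ =>
      gaussianLLR s k (H * p.1) p.2 := by
    unfold gaussianLLR
    fun_prop
  rw [channelJoint, integrable_map_measure hc.aestronglyMeasurable
    (measurable_channel H).aemeasurable, integral_map (measurable_channel H).aemeasurable
    hc.aestronglyMeasurable]
  have hX : ∀ j t, MemLp (fun X : Matrix (Fin N) (Fin T) ℂ => (H * X) j t) 2 μ :=
    fun j t => memLp_mul_entry hμ H j t
  have hZ : ∀ j t, MemLp (fun Z : Matrix (Fin Nc) (Fin T) ℂ => Z j t) 2 G :=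
    fun j t => memLp_entry_gaussianMatrix s j t
  have h1 : ∀ j t, Integrable (fun p : Matrix (Fin N) (Fin T) ℂ × Matrix (Fin Nc) (Fin T) ℂ =>
      ‖p.2 j t‖ ^ 2) (μ.prod G) :=
    fun j t => ((hZ j t).integrable_norm_pow (by norm_num)).comp_snd μ
  have h2 : ∀ j t, Integrable (fun p : Matrix (Fin N) (Fin T) ℂ × Matrix (Fin Nc) (Fin T) ℂ =>
      ‖(H * p.1) j t‖ ^ 2) (μ.prod G) :=
    fun j t => ((hX j t).integrable_norm_pow (by norm_num)).comp_fst G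
  have h3 : ∀ j t, Integrable (fun p : Matrix (Fin N) (Fin T) ℂ × Matrix (Fin Nc) (Fin T) ℂ =>
      (H * p.1) j t * star (p.2 j t)) (μ.prod G) :=
    fun j t => (integrable_of_memLp_two (hX j t)).mul_prod
      (f := fun X : Matrix (Fin N) (Fin T) ℂ => (H * X) j t)
      (integrable_of_memLp_two (hZ j t).star)
  have h1' : ∀ j t, ∫ p, ‖p.2 j t‖ ^ 2 ∂μ.prod G = s := by
    intro j t
    rw [integral_fun_snd (fun Z : Matrix (Fin Nc) (Fin T) ℂ => ‖Z j t‖ ^ 2),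
      integral_normSq_entry_gaussianMatrix hs.le]
    simp
  have h2' : ∀ j t, ∫ p, ‖(H * p.1) j t‖ ^ 2 ∂μ.prod G = ∫ X, ‖(H * X) j t‖ ^ 2 ∂μ := by
    intro j t
    rw [integral_fun_fst (fun X : Matrix (Fin N) (Fin T) ℂ => ‖(H * X) j t‖ ^ 2)]
    simp
  have h3' : ∀ j t, ∫ p, ((H * p.1) j t * star (p.2 j t)).re ∂μ.prod G = 0 := by
    intro j t
    have hr : ∫ p, ((H * p.1) j t * star (p.2 j t)).re ∂μ.prod G =
      (∫ p, (H * p.1) j t * star (p.2 j t) ∂μ.prod G).re := integral_re (h3 j t)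
    have hz : ∫ Z : Matrix (Fin Nc) (Fin T) ℂ, star (Z j t) ∂G = 0 := by
      have : ∫ Z : Matrix (Fin Nc) (Fin T) ℂ, star (Z j t) ∂G = star (∫ Z, Z j t ∂G) := integral_conj
      rw [this, integral_entry_gaussianMatrix, star_zero]
    rw [hr, integral_prod_mul (fun X : Matrix (Fin N) (Fin T) ℂ => (H * X) j t)
      (fun Z : Matrix (Fin Nc) (Fin T) ℂ => star (Z j t)), hz]
    simp
  have hexp : ∀ p : Matrix (Fin N) (Fin T) ℂ × Matrix (Fin Nc) (Fin T) ℂ,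
      gaussianLLR s k (H * p.1) (H * p.1 + p.2) = ∑ j, ∑ t, (Real.log (k j / s) -
        ‖p.2 j t‖ ^ 2 / s + (‖(H * p.1) j t‖ ^ 2 / k j + ‖p.2 j t‖ ^ 2 / k j +
          2 / k j * ((H * p.1) j t * star (p.2 j t)).re)) := by
    intro p
    refine Finset.sum_congr rfl fun j _ => Finset.sum_congr rfl fun t _ => ?_
    rw [Matrix.add_apply, add_sub_cancel_left]
    have : ‖(H * p.1) j t + p.2 j t‖ ^ 2 = ‖(H * p.1) j t‖ ^ 2 + ‖p.2 j t‖ ^ 2 +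
        2 * ((H * p.1) j t * star (p.2 j t)).re := by
      simp only [← Complex.normSq_eq_norm_sq]
      exact Complex.normSq_add _ _
    rw [this]
    ring
  have hi1 : ∀ j t, Integrable (fun p : Matrix (Fin N) (Fin T) ℂ × Matrix (Fin Nc) (Fin T) ℂ =>
      Real.log (k j / s) - ‖p.2 j t‖ ^ 2 / s) (μ.prod G) :=
    fun j t => (integrable_const _).sub ((h1 j t).div_const _)
  have hi2 : ∀ j t, Integrable (fun p : Matrix (Fin N) (Fin T) ℂ × Matrix (Fin Nc) (Fin T) ℂ =>
      ‖(H * p.1) j t‖ ^ 2 / k j + ‖p.2 j t‖ ^ 2 / k j) (μ.prod G) :=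
    fun j t => ((h2 j t).div_const _).add ((h1 j t).div_const _)
  have hi3 : ∀ j t, Integrable (fun p : Matrix (Fin N) (Fin T) ℂ × Matrix (Fin Nc) (Fin T) ℂ =>
      2 / k j * ((H * p.1) j t * star (p.2 j t)).re) (μ.prod G) :=
    fun j t => (h3 j t).re.const_mul _
  have hi23 : ∀ j t, Integrable (fun p : Matrix (Fin N) (Fin T) ℂ × Matrix (Fin Nc) (Fin T) ℂ =>
      ‖(H * p.1) j t‖ ^ 2 / k j + ‖p.2 j t‖ ^ 2 / k j +
        2 / k j * ((H * p.1) j t * star (p.2 j t)).re) (μ.prod G) :=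
    fun j t => (hi2 j t).add (hi3 j t)
  have hi : ∀ j t, Integrable (fun p : Matrix (Fin N) (Fin T) ℂ × Matrix (Fin Nc) (Fin T) ℂ =>
      Real.log (k j / s) - ‖p.2 j t‖ ^ 2 / s + (‖(H * p.1) j t‖ ^ 2 / k j + ‖p.2 j t‖ ^ 2 / k j +
          2 / k j * ((H * p.1) j t * star (p.2 j t)).re)) (μ.prod G) :=
    fun j t => (hi1 j t).add (hi23 j t)
  constructor
  · refine Integrable.congr (integrable_finsetSum Finset.univ fun j _ =>
      integrable_finsetSum Finset.univ fun t _ => hi j t) ?_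
    exact Filter.Eventually.of_forall fun p => (hexp p).symm
  · simp only
    simp_rw [hexp]
    rw [integral_finsetSum _ fun j _ => integrable_finsetSum _ fun t _ => hi j t]
    refine Finset.sum_congr rfl fun j _ => ?_
    rw [integral_finsetSum _ fun t _ => hi j t]
    refine Finset.sum_congr rfl fun t _ => ?_
    rw [integral_add (hi1 j t) (hi23 j t),
      integral_sub (integrable_const _) ((h1 j t).div_const _),
      integral_add (hi2 j t) (hi3 j t), integral_add ((h2 j t).div_const _) ((h1 j t).div_const _),
      integral_div, integral_div, integral_div, integral_const_mul, h1', h2', h3']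
    simp [div_self hs.ne']
    ring

variable {H} in
/-- Let `B` be a unitary matrix that diagonalizes the covariance of the output produced by the
Gaussian input `A W`. Then the mutual information of an arbitrary input, plus the relative entropy
of its output to that Gaussian output, is a function of second moments. -/
lemma mutualInfo_add_klDiv_coloredGaussian (hs : 0 < s) {M : ℕ} {A : Matrix (Fin N) (Fin M) ℂ}
    {B : Matrix (Fin Nc) (Fin Nc) ℂ} (hB : B * Bᴴ = 1) {k : Fin Nc → ℝ} (hk : ∀ j, 0 < k j)
    (hK : B * ((s : ℂ) • 1 + H * A * (H * A)ᴴ) * Bᴴ = Matrix.diagonal fun j => (k j : ℂ))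
    (hμ : ∀ i t, MemLp (fun X : Matrix (Fin N) (Fin T) ℂ => X i t) 2 μ) :
    mutualInfo (channelJoint H s μ) + klDiv (channelJoint (B * H) s μ).snd
      (channelJoint (B * H) s (coloredGaussian T A)).snd =
    ENNReal.ofReal (∑ j, ∑ t, (Real.log (k j / s) - 1 + s / k j +
      (∫ X, ‖(B * H * X) j t‖ ^ 2 ∂μ) / k j)) := by
  -- In the basis `B` the reference output has independent entries with variance `k j` in row j, the
  -- case in which the density is known.
  have hQ : (channelJoint (B * H) s (coloredGaussian T A)).snd = rowGaussian T k := by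
    refine ext_of_matChar fun ξ => ?_
    rw [channelJoint_coloredGaussian_snd _ hs.le, matChar_rowGaussian fun j => (hk j).le]
    have : (s : ℂ) • (1 : Matrix (Fin Nc) (Fin Nc) ℂ) + B * H * A * (B * H * A)ᴴ =
        Matrix.diagonal fun j => (k j : ℂ) := by
      rw [← hK, Matrix.mul_add, Matrix.add_mul, Matrix.mul_smul, Matrix.smul_mul, Matrix.mul_one, hB]
      simp [Matrix.mul_assoc]
    rw [this, Matrix.mul_assoc, trace_conjTranspose_mul]
    congr 1
    push_cast
    congr 2
    refine Finset.sum_congr rfl fun j _ => Finset.sum_congr rfl fun t _ => ?_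
    rw [Matrix.diagonal_mul, ← Complex.conj_mul']
    simp
    ring
  rw [← mutualInfo_channelJoint_unitary H s μ hB hs.le, mutualInfo_add_klDiv_snd, channelJoint_fst,
    hQ]
  obtain ⟨hi, hint⟩ := integral_gaussianLLR (B * H) μ hs k hμ
  rw [← hint]
  refine klDiv_withDensity_exp ?_ (channelJoint_eq_withDensity (B * H) μ hs hk) hi
  unfold gaussianLLR
  exact Continuous.measurable (by fun_prop)

end compensation

end MIMO

/-! ### Diagonalization, the log-det rate and eigenmode decompositions. -/

namespace MIMO

open scoped ComplexOrder

/-! ### Diagonalization -/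

open scoped MatrixOrder in
-- Uniqueness of the positive semidefinite square root. It serves twice: to show U = V, and to
-- recover a positive semidefinite factor from a covariance.
lemma posSemidef_eq_of_mul_self_eq {n : ℕ} {A B : Matrix (Fin n) (Fin n) ℂ} (hA : A.PosSemidef)
    (hB : B.PosSemidef) (h : A * A = B * B) : A = B :=
  (CFC.mul_self_eq_mul_self_iff A B hA.nonneg hB.nonneg).1 h

lemma exists_unitary_diagonal {n : ℕ} {A : Matrix (Fin n) (Fin n) ℂ} (hA : A.IsHermitian) :
    ∃ E : Matrix (Fin n) (Fin n) ℂ, E * Eᴴ = 1 ∧ Eᴴ * E = 1 ∧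
      A = E * Matrix.diagonal (fun i => (hA.eigenvalues i : ℂ)) * Eᴴ := by
  refine ⟨hA.eigenvectorUnitary, ?_, ?_, ?_⟩
  · exact Unitary.coe_mul_star_self _
  · exact Unitary.coe_star_mul_self _
  · have := hA.spectral_theorem
    rwa [Unitary.conjStarAlgAut_apply] at this

lemma posDef_smul_one_add {n m : ℕ} {s : ℝ} (hs : 0 < s) (C : Matrix (Fin n) (Fin m) ℂ) :
    ((s : ℂ) • (1 : Matrix (Fin n) (Fin n) ℂ) + C * Cᴴ).PosDef := by
  have h1 : ((s : ℂ) • (1 : Matrix (Fin n) (Fin n) ℂ)).PosDef :=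
    Matrix.PosDef.one.smul (by exact_mod_cast hs)
  exact h1.add_posSemidef (Matrix.posSemidef_self_mul_conjTranspose C)

/-- The noise term makes the output covariance positive definite, so the `k j` can serve as
variances of the reference law and as denominators. -/
lemma exists_unitary_diagonal_smul_one_add {n m : ℕ} {s : ℝ} (hs : 0 < s)
    (C : Matrix (Fin n) (Fin m) ℂ) :
    ∃ (B : Matrix (Fin n) (Fin n) ℂ) (k : Fin n → ℝ), B * Bᴴ = 1 ∧ (∀ j, 0 < k j) ∧
      B * ((s : ℂ) • 1 + C * Cᴴ) * Bᴴ = Matrix.diagonal fun j => (k j : ℂ) := by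
  have hp := posDef_smul_one_add hs C
  obtain ⟨E, h1, h2, h3⟩ := exists_unitary_diagonal hp.1
  have hpos := hp.eigenvalues_pos
  generalize hp.1.eigenvalues = k at h3 hpos
  refine ⟨Eᴴ, k, by simpa using h2, hpos, ?_⟩
  rw [h3, Matrix.conjTranspose_conjTranspose]
  calc _ = (Eᴴ * E) * Matrix.diagonal (fun i => (k i : ℂ)) * (Eᴴ * E) := by
        simp only [Matrix.mul_assoc]
    _ = _ := by rw [h2, Matrix.one_mul, Matrix.mul_one]

lemma trace_conjTranspose_mul_diagonal_mul {m n : ℕ} (d : Fin m → ℝ)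
    (Y : Matrix (Fin m) (Fin n) ℂ) :
    (Yᴴ * Matrix.diagonal (fun j => (d j : ℂ)) * Y).trace =
      ((∑ j, ∑ t, d j * ‖Y j t‖ ^ 2 : ℝ) : ℂ) := by
  rw [Matrix.mul_assoc, trace_conjTranspose_mul]
  push_cast
  refine Finset.sum_congr rfl fun j _ => Finset.sum_congr rfl fun t _ => ?_
  rw [Matrix.diagonal_mul, ← Complex.conj_mul']
  simp
  ring

lemma mul_conjTranspose_apply_self {m n : ℕ} (Y : Matrix (Fin m) (Fin n) ℂ) (j : Fin m) :
    (Y * Yᴴ) j j = ((∑ t, ‖Y j t‖ ^ 2 : ℝ) : ℂ) := by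
  rw [Matrix.mul_apply]
  push_cast
  exact Finset.sum_congr rfl fun t _ => by simpa using Complex.mul_conj' (Y j t)

/-! ### The rate of a Gaussian input -/

/-- The rate `log det(1 + s⁻¹ H A A† H†)` of the Gaussian input `A W`. -/
noncomputable def logDetRate {Nc N M : ℕ} (s : ℝ) (H : Matrix (Fin Nc) (Fin N) ℂ)
    (A : Matrix (Fin N) (Fin M) ℂ) : ℝ :=
  Real.log (1 + (s : ℂ)⁻¹ • (H * A * (H * A)ᴴ)).det.re

section diagonalized

variable {Nc N M T : ℕ} {H : Matrix (Fin Nc) (Fin N) ℂ} {s : ℝ} {A : Matrix (Fin N) (Fin M) ℂ}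
  {B : Matrix (Fin Nc) (Fin Nc) ℂ} {k : Fin Nc → ℝ}

lemma sum_log_eq_logDetRate (hs : 0 < s) (hB : B * Bᴴ = 1) (hk : ∀ j, 0 < k j)
    (hK : B * ((s : ℂ) • 1 + H * A * (H * A)ᴴ) * Bᴴ = Matrix.diagonal fun j => (k j : ℂ)) :
    ∑ j, Real.log (k j / s) = logDetRate s H A := by
  have hs' : (s : ℂ) ≠ 0 := by exact_mod_cast hs.ne'
  have h1 : B * (1 + (s : ℂ)⁻¹ • (H * A * (H * A)ᴴ)) * Bᴴ =
      Matrix.diagonal fun j => ((k j / s : ℝ) : ℂ) := by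
    have : (1 : Matrix (Fin Nc) (Fin Nc) ℂ) + (s : ℂ)⁻¹ • (H * A * (H * A)ᴴ) =
        (s : ℂ)⁻¹ • ((s : ℂ) • 1 + H * A * (H * A)ᴴ) := by
      rw [smul_add, smul_smul, inv_mul_cancel₀ hs', one_smul]
    rw [this, Matrix.mul_smul, Matrix.smul_mul, hK, ← Matrix.diagonal_smul]
    congr 1
    ext j
    simp
    ring
  have h2 := congrArg Matrix.det h1
  rw [Matrix.det_mul_right_comm, Matrix.det_mul, hB, Matrix.det_one, one_mul,
    Matrix.det_diagonal] at h2
  rw [logDetRate, h2, ← Complex.ofReal_prod, Complex.ofReal_re,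
    Real.log_prod fun j _ => (div_pos (hk j) hs).ne']

lemma sum_normSq_eq (hB : B * Bᴴ = 1)
    (hK : B * ((s : ℂ) • 1 + H * A * (H * A)ᴴ) * Bᴴ = Matrix.diagonal fun j => (k j : ℂ))
    (j : Fin Nc) : ∑ t, ‖(B * H * A) j t‖ ^ 2 = k j - s := by
  have h : (B * H * A) * (B * H * A)ᴴ = Matrix.diagonal (fun j => (k j : ℂ)) - (s : ℂ) • 1 := by
    rw [← hK, Matrix.mul_add, Matrix.add_mul, Matrix.mul_smul, Matrix.smul_mul, Matrix.mul_one, hB]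
    simp [Matrix.mul_assoc]
  have h' := congrFun (congrFun h j) j
  rw [mul_conjTranspose_apply_self] at h'
  have : ((∑ t, ‖(B * H * A) j t‖ ^ 2 : ℝ) : ℂ) = ((k j - s : ℝ) : ℂ) := by
    rw [h']
    simp
  exact_mod_cast this

/-- `k j - s` is the signal power in output mode j. Written this way, the constant has the same form
as the quadratic term of a general input, so the same formula in the eigenmodes evaluates both. -/
lemma sum_one_sub_div_eq (hB : B * Bᴴ = 1) (hk : ∀ j, 0 < k j)
    (hK : B * ((s : ℂ) • 1 + H * A * (H * A)ᴴ) * Bᴴ = Matrix.diagonal fun j => (k j : ℂ)) :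
    ∑ j, (1 - s / k j) = ∑ j, ∑ t, (k j)⁻¹ * ‖(B * H * A) j t‖ ^ 2 := by
  refine Finset.sum_congr rfl fun j _ => ?_
  rw [← Finset.mul_sum, sum_normSq_eq hB hK]
  have := (hk j).ne'
  field_simp

end diagonalized

/-- The input is its own reference, so the divergence of the outputs is zero. The signal power in
mode j is then `k j - s`, and −1 + s/k + (k − s)/k = 0 leaves only the logarithms. -/
lemma mutualInfo_coloredGaussian {Nc N M : ℕ} (T : ℕ) (H : Matrix (Fin Nc) (Fin N) ℂ) {s : ℝ}
    (hs : 0 < s) (A : Matrix (Fin N) (Fin M) ℂ) :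
    mutualInfo (channelJoint H s (coloredGaussian T A)) = ENNReal.ofReal (T * logDetRate s H A) := by
  obtain ⟨B, k, hB, hk, hK⟩ := exists_unitary_diagonal_smul_one_add hs (H * A)
  have hcol := hasIIDGaussianColumns_coloredGaussian T A
  have hcol' := hasIIDGaussianColumns_coloredGaussian T (B * H * A)
  have h := mutualInfo_add_klDiv_coloredGaussian (coloredGaussian T A) hs hB hk hK hcol.memLp
  have hint : ∀ j t, ∫ X, ‖(B * H * X) j t‖ ^ 2 ∂(coloredGaussian T A) = k j - s := by
    intro j t
    have h1 := hcol'.integral_mul_star j j t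
    rw [integral_mul_star_self, mul_conjTranspose_apply_self, sum_normSq_eq hB hK] at h1
    have h2 : ∫ X, ‖X j t‖ ^ 2 ∂(coloredGaussian T (B * H * A)) = k j - s := by exact_mod_cast h1
    rw [← h2, ← map_coloredGaussian, integral_map (measurable_mul_left _).aemeasurable]
    exact Continuous.aestronglyMeasurable (by fun_prop)
  rw [klDiv_self, add_zero] at h
  rw [h, ← sum_log_eq_logDetRate hs hB hk hK, Finset.mul_sum]
  congr 1
  refine Finset.sum_congr rfl fun j _ => ?_
  simp_rw [hint]
  have := (hk j).ne'
  rw [Finset.sum_const, Finset.card_univ, Fintype.card_fin, nsmul_eq_mul]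
  congr 1
  field_simp
  ring

lemma coherentRate_coloredGaussian {Nc N M T : ℕ} (hT : 0 < T) (H : Matrix (Fin Nc) (Fin N) ℂ)
    {s : ℝ} (hs : 0 < s) (A : Matrix (Fin N) (Fin M) ℂ) :
    coherentRate H s (coloredGaussian T A) = ENNReal.ofReal (logDetRate s H A) := by
  rw [coherentRate, mutualInfo_coloredGaussian T H hs, ENNReal.ofReal_mul (by positivity),
    ENNReal.ofReal_natCast, ← mul_assoc, ENNReal.inv_mul_cancel (by exact_mod_cast hT.ne')
    (ENNReal.natCast_ne_top T), one_mul]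

/-! ### Eigenmode decompositions -/

section decomposition

variable {Nc N : ℕ} {H : Matrix (Fin Nc) (Fin N) ℂ} {U V : Matrix (Fin N) (Fin H.rank) ℂ}
  {γ : Fin H.rank → ℝ}

lemma conjTranspose_diagonal_ofReal {r : ℕ} (d : Fin r → ℝ) :
    (Matrix.diagonal fun i => (d i : ℂ))ᴴ = Matrix.diagonal fun i => (d i : ℂ) := by
  rw [Matrix.diagonal_conjTranspose]
  congr 1
  ext i
  simp

lemma diagonal_ofReal_mul {r : ℕ} (d e : Fin r → ℝ) :
    Matrix.diagonal (fun i => (d i : ℂ)) * Matrix.diagonal (fun i => (e i : ℂ)) =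
      Matrix.diagonal fun i => ((d i * e i : ℝ) : ℂ) := by
  rw [Matrix.diagonal_mul_diagonal]
  simp

/-- As H†H is Hermitian, (H†H)² = UΓV†·VΓU† = (UΓU†)². Both H†H and UΓU† are positive semidefinite,
so they agree, and the invertible Γ cancels from VΓU† = UΓU†. -/
lemma IsEigenmodeDecomposition.left_eq_right (h : IsEigenmodeDecomposition H U V γ) : U = V := by
  set Γ : Matrix (Fin H.rank) (Fin H.rank) ℂ := Matrix.diagonal fun i => (γ i : ℂ) with hΓ
  have hΓs : Γᴴ = Γ := conjTranspose_diagonal_ofReal γ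
  have hA : Hᴴ * H = V * Γ * Uᴴ := by
    have := congrArg Matrix.conjTranspose h.decomposition
    rwa [Matrix.conjTranspose_mul, Matrix.conjTranspose_conjTranspose, Matrix.conjTranspose_mul,
      Matrix.conjTranspose_mul, Matrix.conjTranspose_conjTranspose, hΓs, ← Matrix.mul_assoc] at this
  have hsq : (Hᴴ * H) * (Hᴴ * H) = (U * Γ * Uᴴ) * (U * Γ * Uᴴ) := by
    nth_rw 1 [h.decomposition]
    rw [hA]
    calc U * Γ * Vᴴ * (V * Γ * Uᴴ) = U * Γ * (Vᴴ * V) * Γ * Uᴴ := by simp only [Matrix.mul_assoc]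
      _ = U * Γ * (Uᴴ * U) * Γ * Uᴴ := by rw [h.right, h.left]
      _ = _ := by simp only [Matrix.mul_assoc]
  have hpsd : (U * Γ * Uᴴ).PosSemidef :=
    Matrix.PosSemidef.mul_mul_conjTranspose_same (Matrix.PosSemidef.diagonal fun i => by
      simpa using (h.pos i).le) U
  have heq := posSemidef_eq_of_mul_self_eq (Matrix.posSemidef_conjTranspose_mul_self H) hpsd hsq
  have hinv : Γ * Matrix.diagonal (fun i => (((γ i)⁻¹ : ℝ) : ℂ)) = 1 := by
    rw [hΓ, diagonal_ofReal_mul]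
    simp [mul_inv_cancel₀ (h.pos _).ne']
  rw [hA] at heq
  calc U = U * (Γ * Matrix.diagonal (fun i => (((γ i)⁻¹ : ℝ) : ℂ))) := by rw [hinv, Matrix.mul_one]
    _ = U * Γ * (Uᴴ * U) * Matrix.diagonal (fun i => (((γ i)⁻¹ : ℝ) : ℂ)) := by
      rw [h.left, Matrix.mul_one, Matrix.mul_assoc]
    _ = (U * Γ * Uᴴ) * U * Matrix.diagonal (fun i => (((γ i)⁻¹ : ℝ) : ℂ)) := by
      simp only [Matrix.mul_assoc]
    _ = V * Γ * (Uᴴ * U) * Matrix.diagonal (fun i => (((γ i)⁻¹ : ℝ) : ℂ)) := by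
      rw [← heq]; simp only [Matrix.mul_assoc]
    _ = V := by rw [h.left, Matrix.mul_one, Matrix.mul_assoc, hinv, Matrix.mul_one]

lemma IsEigenmodeDecomposition.gram (h : IsEigenmodeDecomposition H U V γ) :
    Hᴴ * H = U * Matrix.diagonal (fun i => (γ i : ℂ)) * Uᴴ := by
  have := h.decomposition
  rwa [← h.left_eq_right] at this

lemma IsEigenmodeDecomposition.gram_mul (h : IsEigenmodeDecomposition H U V γ) :
    Hᴴ * H * U = U * Matrix.diagonal (fun i => (γ i : ℂ)) := by
  rw [h.gram, Matrix.mul_assoc, h.left, Matrix.mul_one]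

/-- H annihilates the complement of the range of U: the Gram matrix of the difference vanishes
because H†H UU† = H†H. -/
lemma IsEigenmodeDecomposition.mul_projection (h : IsEigenmodeDecomposition H U V γ) :
    H * (U * Uᴴ) = H := by
  have h0 : (H * (U * Uᴴ) - H)ᴴ * (H * (U * Uᴴ) - H) = 0 := by
    have h1 : Hᴴ * (H * (U * Uᴴ) - H) = 0 := by
      calc Hᴴ * (H * (U * Uᴴ) - H) = Hᴴ * H * U * Uᴴ - Hᴴ * H := by
            rw [Matrix.mul_sub]
            simp only [Matrix.mul_assoc]
        _ = 0 := by rw [h.gram_mul, ← h.gram, sub_self]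
    rw [Matrix.conjTranspose_sub, Matrix.conjTranspose_mul, Matrix.sub_mul, Matrix.mul_assoc, h1,
      Matrix.mul_zero, sub_zero]
  exact sub_eq_zero.1 (Matrix.conjTranspose_mul_self_eq_zero.1 h0)

lemma mul_diagonal_mul_conjTranspose_apply {n r : ℕ} (E : Matrix (Fin n) (Fin r) ℂ)
    (d : Fin r → ℂ) (a b : Fin n) :
    (E * Matrix.diagonal d * Eᴴ) a b = ∑ j, E a j * d j * star (E b j) := by
  rw [Matrix.mul_apply]
  simp_rw [Matrix.mul_diagonal, Matrix.conjTranspose_apply]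

/-- Keep the eigenvectors of H†H with nonzero eigenvalue; there are rank(H†H) = rank H of them. -/
lemma exists_isEigenmodeDecomposition (H : Matrix (Fin Nc) (Fin N) ℂ) :
    ∃ U V γ, IsEigenmodeDecomposition H U V γ := by
  have hA : (Hᴴ * H).IsHermitian := Matrix.isHermitian_conjTranspose_mul_self H
  obtain ⟨E, h1, h2, h3⟩ := exists_unitary_diagonal hA
  have hcard : Fintype.card {i // hA.eigenvalues i ≠ 0} = Fintype.card (Fin H.rank) := by
    rw [← hA.rank_eq_card_non_zero_eigs, Matrix.rank_conjTranspose_mul_self, Fintype.card_fin]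
  let e : Fin H.rank ≃ {i // hA.eigenvalues i ≠ 0} := (Fintype.equivOfCardEq hcard).symm
  have horth : (E.submatrix id fun a => (e a : Fin N))ᴴ * E.submatrix id (fun a => (e a : Fin N)) =
      1 := by
    ext a b
    refine (congrFun (congrFun h2 (e a)) (e b)).trans ?_
    by_cases hab : a = b
    · rw [hab, Matrix.one_apply_eq, Matrix.one_apply_eq]
    · rw [Matrix.one_apply_ne hab, Matrix.one_apply_ne]
      exact fun h => hab (e.injective (Subtype.ext h))
  refine ⟨E.submatrix id fun a => (e a : Fin N), E.submatrix id fun a => (e a : Fin N),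
    fun a => hA.eigenvalues (e a), horth, horth, fun a => ?_, ?_⟩
  · exact lt_of_le_of_ne (Matrix.eigenvalues_conjTranspose_mul_self_nonneg H _) (e a).2.symm
  · conv_lhs => rw [h3]
    ext a b
    rw [mul_diagonal_mul_conjTranspose_apply, mul_diagonal_mul_conjTranspose_apply]
    have hsub : ∑ j, E a j * (hA.eigenvalues j : ℂ) * star (E b j) =
        ∑ j : {i // hA.eigenvalues i ≠ 0}, E a j * (hA.eigenvalues j : ℂ) * star (E b j) := by
      rw [← Finset.sum_subtype (Finset.univ.filter fun i => hA.eigenvalues i ≠ 0) (by simp)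
        fun j => E a j * (hA.eigenvalues j : ℂ) * star (E b j), Finset.sum_filter_of_ne]
      intro j _ hj h0
      simp [h0] at hj
    rw [hsub, ← Equiv.sum_comp e]
    rfl

end decomposition

end MIMO

/-! ### Water-filling and the upper bound on mutual information. -/

namespace MIMO

open scoped ComplexOrder

/-! ### The water level -/

lemma waterPower_nonneg (s η γ : ℝ) : 0 ≤ waterPower s η γ := le_max_right _ _

lemma waterPower_mono {s γ η η' : ℝ} (h : η ≤ η') : waterPower s η γ ≤ waterPower s η' γ :=
  max_le_max (by linarith) le_rfl

/-- A positive budget forces an active mode. Positivity of η and uniqueness of the level both rest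
on this. -/
lemma IsWaterLevel.exists_pos {r : ℕ} {γ : Fin r → ℝ} {s P η : ℝ} (hP : 0 < P)
    (hη : IsWaterLevel γ s P η) : ∃ i, 0 < η - s / γ i := by
  by_contra! h
  have : ∑ i, waterPower s η (γ i) = 0 :=
    Finset.sum_eq_zero fun i _ => max_eq_right (h i)
  exact hP.ne' (hη.symm.trans this)

lemma IsWaterLevel.pos {r : ℕ} {γ : Fin r → ℝ} {s P η : ℝ} (hγ : ∀ i, 0 < γ i) (hs : 0 < s)
    (hP : 0 < P) (hη : IsWaterLevel γ s P η) : 0 < η := by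
  obtain ⟨i, hi⟩ := hη.exists_pos hP
  have := div_pos hs (hγ i)
  linarith

/-- The total power is continuous in η, zero at η = 0, and at least P at s/γ₀ + P, where one mode
alone absorbs P. Raising the level strictly raises the power of a mode that is already active,
whence uniqueness. -/
lemma existsUnique_isWaterLevel {r : ℕ} (hr : 0 < r) {γ : Fin r → ℝ} (hγ : ∀ i, 0 < γ i)
    {s P : ℝ} (hs : 0 < s) (hP : 0 < P) : ∃! η, IsWaterLevel γ s P η := by
  set f : ℝ → ℝ := fun η => ∑ i, waterPower s η (γ i) with hf
  have hc : Continuous f := by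
    unfold f waterPower
    fun_prop
  have h0 : f 0 = 0 := Finset.sum_eq_zero fun i _ => max_eq_right (by
    have := div_pos hs (hγ i)
    linarith)
  let i₀ : Fin r := ⟨0, hr⟩
  have hb : 0 ≤ s / γ i₀ + P := by
    have := div_pos hs (hγ i₀)
    linarith
  have h1 : P ≤ f (s / γ i₀ + P) := by
    calc P ≤ waterPower s (s / γ i₀ + P) (γ i₀) := le_max_of_le_left (by linarith)
      _ ≤ f (s / γ i₀ + P) := Finset.single_le_sum
          (f := fun i => waterPower s (s / γ i₀ + P) (γ i))
          (fun i _ => waterPower_nonneg _ _ _) (Finset.mem_univ i₀)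
  obtain ⟨η, -, hη⟩ := intermediate_value_Icc hb hc.continuousOn ⟨h0.le.trans hP.le, h1⟩
  have hlt : ∀ a b, IsWaterLevel γ s P a → IsWaterLevel γ s P b → ¬ a < b := by
    intro a b ha hb hab
    obtain ⟨i, hi⟩ := ha.exists_pos hP
    have hsum : ∑ i, waterPower s a (γ i) < ∑ i, waterPower s b (γ i) := by
      refine Finset.sum_lt_sum (fun i _ => waterPower_mono hab.le) ⟨i, Finset.mem_univ i, ?_⟩
      rw [waterPower, waterPower, max_eq_left hi.le]
      exact lt_max_of_lt_left (by linarith)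
    rw [IsWaterLevel] at ha hb
    linarith
  exact ⟨η, hη, fun η' hη' => le_antisymm (not_lt.1 (hlt _ _ hη hη')) (not_lt.1 (hlt _ _ hη' hη))⟩

/-! ### The water-filling waveform -/

/-- The matrix `V P^{1/2}` that colours the water-filling waveform. -/
noncomputable def waterFillingRoot {N r : ℕ} (V : Matrix (Fin N) (Fin r) ℂ) (γ : Fin r → ℝ) (s η : ℝ) :
    Matrix (Fin N) (Fin r) ℂ :=
  V * Matrix.diagonal (fun i => ((Real.sqrt (waterPower s η (γ i)) : ℝ) : ℂ))

lemma waterFillingLaw_eq_coloredGaussian (T : ℕ) {N r : ℕ} (V : Matrix (Fin N) (Fin r) ℂ)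
    (γ : Fin r → ℝ) (s η : ℝ) :
    waterFillingLaw T V γ s η = coloredGaussian T (waterFillingRoot V γ s η) := rfl

lemma waterFillingRoot_mul_conjTranspose {N r : ℕ} (V : Matrix (Fin N) (Fin r) ℂ) (γ : Fin r → ℝ)
    (s η : ℝ) : waterFillingRoot V γ s η * (waterFillingRoot V γ s η)ᴴ =
      waterFillingCovariance V V γ s η := by
  rw [waterFillingRoot, Matrix.conjTranspose_mul, conjTranspose_diagonal_ofReal,
    waterFillingCovariance]
  calc _ = V * (Matrix.diagonal (fun i => ((√(waterPower s η (γ i)) : ℝ) : ℂ)) *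
        Matrix.diagonal (fun i => ((√(waterPower s η (γ i)) : ℝ) : ℂ))) * Vᴴ := by
        simp only [Matrix.mul_assoc]
    _ = _ := by
      rw [diagonal_ofReal_mul]
      simp_rw [Real.mul_self_sqrt (waterPower_nonneg _ _ _)]

/-- The squared Frobenius norm. -/
noncomputable def frobSq {m n : ℕ} (X : Matrix (Fin m) (Fin n) ℂ) : ℝ := ∑ i, ∑ t, ‖X i t‖ ^ 2

lemma frobSq_nonneg {m n : ℕ} (X : Matrix (Fin m) (Fin n) ℂ) : 0 ≤ frobSq X :=
  Finset.sum_nonneg fun _ _ => Finset.sum_nonneg fun _ _ => sq_nonneg _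

lemma frobSq_eq_zero {m n : ℕ} {X : Matrix (Fin m) (Fin n) ℂ} (h : frobSq X = 0) : X = 0 := by
  ext i t
  rw [frobSq, Finset.sum_eq_zero_iff_of_nonneg fun _ _ => Finset.sum_nonneg fun _ _ => sq_nonneg _]
    at h
  have h' := h i (Finset.mem_univ i)
  rw [Finset.sum_eq_zero_iff_of_nonneg fun _ _ => sq_nonneg _] at h'
  simpa using h' t (Finset.mem_univ t)

lemma trace_conjTranspose_mul_self_eq_frobSq {m n : ℕ} (X : Matrix (Fin m) (Fin n) ℂ) :
    (Xᴴ * X).trace = (frobSq X : ℂ) := trace_conjTranspose_mul_self X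

lemma frobSq_projection {N r n : ℕ} {U : Matrix (Fin N) (Fin r) ℂ} (hU : Uᴴ * U = 1)
    (X : Matrix (Fin N) (Fin n) ℂ) :
    frobSq X = frobSq (Uᴴ * X) + frobSq (X - U * Uᴴ * X) := by
  have h : Xᴴ * X = (Uᴴ * X)ᴴ * (Uᴴ * X) + (X - U * Uᴴ * X)ᴴ * (X - U * Uᴴ * X) := by
    have h1 : U * Uᴴ * (U * Uᴴ) = U * Uᴴ := by
      rw [Matrix.mul_assoc, ← Matrix.mul_assoc Uᴴ, hU, Matrix.one_mul]
    have h2 : Xᴴ * (U * Uᴴ) * (U * Uᴴ * X) = Xᴴ * (U * Uᴴ) * X := by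
      rw [Matrix.mul_assoc, ← Matrix.mul_assoc (U * Uᴴ), h1, ← Matrix.mul_assoc]
    have h3 : (X - U * Uᴴ * X)ᴴ = Xᴴ - Xᴴ * (U * Uᴴ) := by
      simp [Matrix.mul_assoc]
    have h4 : (Uᴴ * X)ᴴ * (Uᴴ * X) = Xᴴ * (U * Uᴴ) * X := by
      simp [Matrix.mul_assoc]
    rw [h3, h4, Matrix.sub_mul, Matrix.mul_sub, Matrix.mul_sub, h2, ← Matrix.mul_assoc Xᴴ (U * Uᴴ)]
    abel
  have := congrArg Matrix.trace h
  rw [Matrix.trace_add] at this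
  simp only [trace_conjTranspose_mul_self_eq_frobSq] at this
  exact_mod_cast this

section waterFilling

variable {Nc N T : ℕ} {H : Matrix (Fin Nc) (Fin N) ℂ} {U V : Matrix (Fin N) (Fin H.rank) ℂ}
  {γ : Fin H.rank → ℝ} {s P η : ℝ}

lemma IsEigenmodeDecomposition.waterFillingCovariance_eq (h : IsEigenmodeDecomposition H U V γ) :
    waterFillingCovariance U V γ s η =
      waterFillingRoot V γ s η * (waterFillingRoot V γ s η)ᴴ := by
  rw [waterFillingRoot_mul_conjTranspose, h.left_eq_right]

lemma IsEigenmodeDecomposition.rank_pos (h : IsEigenmodeDecomposition H U V γ) (hH : H ≠ 0) :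
    0 < H.rank := by
  by_contra h0
  have h0 : H.rank = 0 := by omega
  have : IsEmpty (Fin H.rank) := by rw [h0]; infer_instance
  apply hH
  rw [← h.mul_projection]
  have : U * Uᴴ = 0 := by
    ext i j
    rw [Matrix.mul_apply]
    simp
  rw [this, Matrix.mul_zero]

/-- The argument of the logarithm equals max(s⁻¹ηg, 1): an inactive mode contributes log 1. -/
lemma one_add_waterPower (hs : 0 < s) (hη : 0 < η) {g : ℝ} (hg : 0 < g) :
    Real.log (1 + s⁻¹ * (g * waterPower s η g)) = max (Real.log (s⁻¹ * η * g)) 0 := by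
  have h1 : 1 + s⁻¹ * (g * waterPower s η g) = max (s⁻¹ * η * g) 1 := by
    rw [waterPower, mul_max_of_nonneg _ _ hg.le, mul_max_of_nonneg _ _ (by positivity),
      ← max_add_add_left]
    congr 1
    · field_simp
      ring
    · simp
  rw [h1]
  rcases le_total (s⁻¹ * η * g) 1 with h | h
  · rw [max_eq_right h, Real.log_one, max_eq_right (Real.log_nonpos (by positivity) h)]
  · rw [max_eq_left h, max_eq_left (Real.log_nonneg h)]

/-- The identity det(1 + CC†) = det(1 + C†C) moves the determinant to the eigenmodes, where the Gram
matrix is diagonal. -/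
lemma IsEigenmodeDecomposition.logDetRate_waterFillingRoot (h : IsEigenmodeDecomposition H U V γ)
    (hs : 0 < s) (hη : 0 < η) :
    logDetRate s H (waterFillingRoot V γ s η) = waterFillingRate γ s η := by
  set d : Fin H.rank → ℝ := fun i => √(waterPower s η (γ i)) with hd
  have hgram : (H * waterFillingRoot V γ s η)ᴴ * (H * waterFillingRoot V γ s η) =
      Matrix.diagonal fun i => ((γ i * waterPower s η (γ i) : ℝ) : ℂ) := by
    have e1 : (H * waterFillingRoot V γ s η)ᴴ * (H * waterFillingRoot V γ s η) =
        Matrix.diagonal (fun i => (d i : ℂ)) * (Vᴴ * (Hᴴ * H * V)) *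
          Matrix.diagonal (fun i => (d i : ℂ)) := by
      rw [waterFillingRoot, Matrix.conjTranspose_mul, Matrix.conjTranspose_mul,
        conjTranspose_diagonal_ofReal]
      simp only [Matrix.mul_assoc, hd]
    have e2 : Hᴴ * H * V = V * Matrix.diagonal (fun i => (γ i : ℂ)) := by
      have := h.gram_mul
      rwa [h.left_eq_right] at this
    rw [e1, e2, ← Matrix.mul_assoc Vᴴ, h.right, Matrix.one_mul, diagonal_ofReal_mul,
      diagonal_ofReal_mul]
    congr 1
    ext i
    have := Real.mul_self_sqrt (waterPower_nonneg s η (γ i))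
    congr 1
    simp only [hd]
    linear_combination γ i * this
  have hdet : (1 + (s : ℂ)⁻¹ • (H * waterFillingRoot V γ s η * (H * waterFillingRoot V γ s η)ᴴ)).det
      = ((∏ i, (1 + s⁻¹ * (γ i * waterPower s η (γ i))) : ℝ) : ℂ) := by
    rw [← Matrix.smul_mul, Matrix.det_one_add_mul_comm, Matrix.mul_smul, hgram,
      ← Matrix.diagonal_smul, ← Matrix.diagonal_one, Matrix.diagonal_add, Matrix.det_diagonal]
    push_cast
    simp
  have hpos : ∀ i, 0 < 1 + s⁻¹ * (γ i * waterPower s η (γ i)) := fun i => by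
    have := mul_nonneg (h.pos i).le (waterPower_nonneg s η (γ i))
    positivity
  rw [logDetRate, hdet, Complex.ofReal_re, Real.log_prod fun i _ => (hpos i).ne', waterFillingRate]
  exact Finset.sum_congr rfl fun i _ => one_add_waterPower hs hη (h.pos i)

lemma IsEigenmodeDecomposition.projection_mul_waterFillingRoot
    (h : IsEigenmodeDecomposition H U V γ) :
    U * Uᴴ * waterFillingRoot V γ s η = waterFillingRoot V γ s η := by
  rw [waterFillingRoot, ← h.left_eq_right, Matrix.mul_assoc, ← Matrix.mul_assoc Uᴴ, h.left,
    Matrix.one_mul]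

/-- The left side is tr(X†H†K⁻¹HX), K being the output covariance. K maps HU to HU·diag(s + γᵢpᵢ),
so K⁻¹ acts there by the reciprocals and H†K⁻¹H = U diag(γᵢ/(s + γᵢpᵢ)) U†. -/
lemma IsEigenmodeDecomposition.sum_weighted (h : IsEigenmodeDecomposition H U V γ) (hs : 0 < s)
    {B : Matrix (Fin Nc) (Fin Nc) ℂ} {k : Fin Nc → ℝ} (hB : B * Bᴴ = 1) (hk : ∀ j, 0 < k j)
    (hK : B * ((s : ℂ) • 1 + H * waterFillingRoot V γ s η * (H * waterFillingRoot V γ s η)ᴴ) * Bᴴ =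
      Matrix.diagonal fun j => (k j : ℂ)) {n : ℕ} (X : Matrix (Fin N) (Fin n) ℂ) :
    ∑ j, ∑ t, (k j)⁻¹ * ‖(B * H * X) j t‖ ^ 2 =
      ∑ i, ∑ t, (γ i / (s + γ i * waterPower s η (γ i))) * ‖(Uᴴ * X) i t‖ ^ 2 := by
  set S := waterFillingRoot V γ s η with hS
  set K := (s : ℂ) • (1 : Matrix (Fin Nc) (Fin Nc) ℂ) + H * S * (H * S)ᴴ with hKdef
  set p : Fin H.rank → ℝ := fun i => waterPower s η (γ i) with hp
  have hq : ∀ i, 0 < s + γ i * p i := fun i => by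
    have := mul_nonneg (h.pos i).le (waterPower_nonneg s η (γ i))
    positivity
  have hB' : Bᴴ * B = 1 := mul_eq_one_comm.1 hB
  set D : Matrix (Fin Nc) (Fin Nc) ℂ := Matrix.diagonal fun j => (((k j)⁻¹ : ℝ) : ℂ) with hD
  -- `G` is K⁻¹, assembled from the diagonalization.
  set G := Bᴴ * D * B with hG
  have hGK : G * K = 1 := by
    have hBK : B * K = Matrix.diagonal (fun j => (k j : ℂ)) * B := by
      rw [← hK, Matrix.mul_assoc, hB', Matrix.mul_one]
    have hDk : D * Matrix.diagonal (fun j => (k j : ℂ)) = 1 := by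
      rw [hD, diagonal_ofReal_mul]
      simp [inv_mul_cancel₀ (hk _).ne']
    calc G * K = Bᴴ * (D * (B * K)) := by simp only [hG, Matrix.mul_assoc]
      _ = Bᴴ * (D * Matrix.diagonal (fun j => (k j : ℂ)) * B) := by
        rw [hBK, Matrix.mul_assoc]
      _ = 1 := by rw [hDk, Matrix.one_mul, hB']
  have hKU : K * (H * U) = H * U * Matrix.diagonal (fun i => ((s + γ i * p i : ℝ) : ℂ)) := by
    have hSS : S * Sᴴ = U * Matrix.diagonal (fun i => (p i : ℂ)) * Uᴴ := by
      rw [hS, waterFillingRoot_mul_conjTranspose, ← h.left_eq_right, waterFillingCovariance]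
    have e1 : H * S * (H * S)ᴴ * (H * U) = H * U * Matrix.diagonal (fun i => ((γ i * p i : ℝ) : ℂ)) := by
      calc H * S * (H * S)ᴴ * (H * U) = H * (S * Sᴴ) * (Hᴴ * H * U) := by
            rw [Matrix.conjTranspose_mul]
            simp only [Matrix.mul_assoc]
        _ = H * U * Matrix.diagonal (fun i => (p i : ℂ)) * (Uᴴ * U) *
              Matrix.diagonal (fun i => (γ i : ℂ)) := by
            rw [hSS, h.gram_mul]
            simp only [Matrix.mul_assoc]
        _ = _ := by
            rw [h.left, Matrix.mul_one, Matrix.mul_assoc, diagonal_ofReal_mul]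
            simp_rw [mul_comm]
    rw [hKdef, Matrix.add_mul, e1, Matrix.smul_mul, Matrix.one_mul, ← Matrix.mul_one ((s : ℂ) • _),
      Matrix.smul_mul, ← Matrix.mul_smul, ← Matrix.mul_add, ← Matrix.diagonal_one,
      ← Matrix.diagonal_smul, Matrix.diagonal_add]
    congr 2
    ext i
    simp
  have hGU : G * (H * U) = H * U * Matrix.diagonal (fun i => (((s + γ i * p i)⁻¹ : ℝ) : ℂ)) := by
    have hinv : Matrix.diagonal (fun i => ((s + γ i * p i : ℝ) : ℂ)) *
        Matrix.diagonal (fun i => (((s + γ i * p i)⁻¹ : ℝ) : ℂ)) = 1 := by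
      rw [diagonal_ofReal_mul]
      simp_rw [mul_inv_cancel₀ (hq _).ne']
      simp
    calc G * (H * U) = G * (H * U * (Matrix.diagonal (fun i => ((s + γ i * p i : ℝ) : ℂ)) *
        Matrix.diagonal (fun i => (((s + γ i * p i)⁻¹ : ℝ) : ℂ)))) := by rw [hinv, Matrix.mul_one]
      _ = G * (K * (H * U)) * Matrix.diagonal (fun i => (((s + γ i * p i)⁻¹ : ℝ) : ℂ)) := by
        rw [hKU]
        simp only [Matrix.mul_assoc]
      _ = _ := by rw [← Matrix.mul_assoc G, hGK, Matrix.one_mul]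
  have hM : Hᴴ * G * H = U * Matrix.diagonal (fun i => ((γ i / (s + γ i * p i) : ℝ) : ℂ)) * Uᴴ := by
    calc Hᴴ * G * H = Hᴴ * G * (H * (U * Uᴴ)) := by rw [h.mul_projection]
      _ = Hᴴ * (G * (H * U)) * Uᴴ := by simp only [Matrix.mul_assoc]
      _ = Hᴴ * H * U * Matrix.diagonal (fun i => (((s + γ i * p i)⁻¹ : ℝ) : ℂ)) * Uᴴ := by
        rw [hGU]
        simp only [Matrix.mul_assoc]
      _ = _ := by
        rw [h.gram_mul, Matrix.mul_assoc U, diagonal_ofReal_mul]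
        simp_rw [div_eq_mul_inv]
  have e1 := trace_conjTranspose_mul_diagonal_mul (fun j => (k j)⁻¹) (B * H * X)
  have e2 := trace_conjTranspose_mul_diagonal_mul (fun i => γ i / (s + γ i * p i)) (Uᴴ * X)
  have e3 : (B * H * X)ᴴ * D * (B * H * X) = (Uᴴ * X)ᴴ *
      Matrix.diagonal (fun i => ((γ i / (s + γ i * p i) : ℝ) : ℂ)) * (Uᴴ * X) := by
    calc (B * H * X)ᴴ * D * (B * H * X) = Xᴴ * (Hᴴ * G * H) * X := by
          simp only [hG, Matrix.conjTranspose_mul, Matrix.mul_assoc]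
      _ = _ := by
          rw [hM]
          simp only [Matrix.conjTranspose_mul, Matrix.conjTranspose_conjTranspose, Matrix.mul_assoc]
  rw [e3, e2] at e1
  exact_mod_cast e1.symm

/-- The weight is the derivative of p ↦ log(1 + gp/s) at the allocated power. No mode has a marginal
rate above the multiplier 1/η. -/
lemma weight_le (hs : 0 < s) (hη : 0 < η) {g : ℝ} (hg : 0 < g) :
    g / (s + g * waterPower s η g) ≤ η⁻¹ := by
  have h1 : g * (η - s / g) ≤ g * waterPower s η g :=
    mul_le_mul_of_nonneg_left (le_max_left _ _) hg.le
  have h2 : g * (η - s / g) = g * η - s := by field_simp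
  have h3 := mul_nonneg hg.le (waterPower_nonneg s η g)
  rw [div_le_iff₀ (by positivity), inv_mul_eq_div, le_div_iff₀ hη]
  linarith

/-- Complementary slackness: the marginal rate equals 1/η on active modes, and inactive ones have
zero power. -/
lemma weight_mul_waterPower (hη : 0 < η) {g : ℝ} (hg : 0 < g) :
    g / (s + g * waterPower s η g) * waterPower s η g = η⁻¹ * waterPower s η g := by
  rcases le_total (η - s / g) 0 with h | h
  · rw [waterPower, max_eq_right h, mul_zero, mul_zero]
  · rw [waterPower, max_eq_left h]
    have : s + g * (η - s / g) = g * η := by field_simp; ring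
    rw [this]
    congr 1
    field_simp

/-- By complementary slackness the weighted powers sum to η⁻¹ Σ pᵢ. This is the constant that will
cancel against the power constraint. -/
lemma IsEigenmodeDecomposition.sum_one_sub_div (h : IsEigenmodeDecomposition H U V γ) (hs : 0 < s)
    (hP : 0 < P) (hη : IsWaterLevel γ s P η)
    {B : Matrix (Fin Nc) (Fin Nc) ℂ} {k : Fin Nc → ℝ} (hB : B * Bᴴ = 1) (hk : ∀ j, 0 < k j)
    (hK : B * ((s : ℂ) • 1 + H * waterFillingRoot V γ s η * (H * waterFillingRoot V γ s η)ᴴ) * Bᴴ =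
      Matrix.diagonal fun j => (k j : ℂ)) :
    ∑ j, (1 - s / k j) = η⁻¹ * P := by
  have hη0 := hη.pos h.pos hs hP
  rw [sum_one_sub_div_eq hB hk hK, h.sum_weighted hs hB hk hK]
  have hUS : Uᴴ * waterFillingRoot V γ s η =
      Matrix.diagonal (fun i => ((√(waterPower s η (γ i)) : ℝ) : ℂ)) := by
    rw [waterFillingRoot, ← h.left_eq_right, ← Matrix.mul_assoc, h.left, Matrix.one_mul]
  rw [hUS, ← hη, Finset.mul_sum]
  refine Finset.sum_congr rfl fun i _ => ?_
  rw [Finset.sum_eq_single i (fun t _ ht => by simp [Matrix.diagonal_apply_ne' _ ht]) (by simp),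
    Matrix.diagonal_apply_eq, Complex.norm_real, Real.norm_of_nonneg (Real.sqrt_nonneg _),
    Real.sq_sqrt (waterPower_nonneg _ _ _), weight_mul_waterPower hη0 (h.pos i)]

/-! ### Optimality -/

lemma integrable_frobSq_mul {μ : Measure (Matrix (Fin N) (Fin T) ℂ)}
    (hμ : ∀ i t, MemLp (fun X : Matrix (Fin N) (Fin T) ℂ => X i t) 2 μ) {l : ℕ}
    (A : Matrix (Fin l) (Fin N) ℂ) : Integrable (fun X => frobSq (A * X)) μ :=
  integrable_finsetSum _ fun j _ => integrable_finsetSum _ fun t _ =>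
    (memLp_mul_entry hμ A j t).integrable_norm_pow (by norm_num)

lemma IsAdmissible.integral_frobSq_le {μ : Measure (Matrix (Fin N) (Fin T) ℂ)} (hT : 0 < T)
    (hμ : IsAdmissible P μ) : ∫ X, frobSq X ∂μ ≤ T * P := by
  have hT' : (0 : ℝ) < T := by exact_mod_cast hT
  have h : (correlationMatrix μ).trace.re = (T : ℝ)⁻¹ * ∫ X, frobSq X ∂μ := by
    have hi : ∀ i t, Integrable (fun X : Matrix (Fin N) (Fin T) ℂ => ‖X i t‖ ^ 2) μ := fun i t =>
      (hμ.secondMoment i t).integrable_norm_pow (by norm_num)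
    unfold frobSq
    rw [integral_finsetSum _ fun i _ => integrable_finsetSum _ fun t _ => hi i t]
    simp_rw [integral_finsetSum _ fun t _ => hi _ t]
    rw [Matrix.trace, Complex.re_sum, Finset.mul_sum]
    refine Finset.sum_congr rfl fun i _ => ?_
    rw [Matrix.diag_apply, correlationMatrix_apply hμ.secondMoment]
    simp_rw [integral_mul_star_self]
    rw [← Complex.ofReal_sum, ← Complex.ofReal_natCast, ← Complex.ofReal_inv, ← Complex.ofReal_mul,
      Complex.ofReal_re]
  have := hμ.power
  rw [h, inv_mul_le_iff₀ hT'] at this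
  exact this

/-- The central inequality. Bounding the weights by 1/η leaves η⁻¹E‖UU†X‖², which is η⁻¹E‖X‖² minus
the wasted power; E‖X‖² ≤ TP then cancels the constant −η⁻¹TP. Both slack terms are retained because
their vanishing gives uniqueness. -/
lemma IsEigenmodeDecomposition.mutualInfo_add_le (h : IsEigenmodeDecomposition H U V γ)
    (hs : 0 < s) (hP : 0 < P) (hT : 0 < T) (hη : IsWaterLevel γ s P η) :
    ∃ B : Matrix (Fin Nc) (Fin Nc) ℂ, B * Bᴴ = 1 ∧
    ∀ μ : Measure (Matrix (Fin N) (Fin T) ℂ), IsAdmissible P μ →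
      mutualInfo (channelJoint H s μ) +
        klDiv (channelJoint (B * H) s μ).snd (channelJoint (B * H) s (waterFillingLaw T V γ s η)).snd +
        ENNReal.ofReal (η⁻¹ * ∫ X, frobSq (X - U * Uᴴ * X) ∂μ) ≤
      ENNReal.ofReal (T * waterFillingRate γ s η) := by
  have hη0 := hη.pos h.pos hs hP
  obtain ⟨B, k, hB, hk, hK⟩ :=
    exists_unitary_diagonal_smul_one_add hs (H * waterFillingRoot V γ s η)
  refine ⟨B, hB, fun μ hμ => ?_⟩
  have := hμ.probability
  have hsm := hμ.secondMoment
  have hfrob : ∀ X : Matrix (Fin N) (Fin T) ℂ, X - U * Uᴴ * X = (1 - U * Uᴴ) * X := fun X => by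
    rw [Matrix.sub_mul, Matrix.one_mul]
  have hint1 : Integrable (fun X : Matrix (Fin N) (Fin T) ℂ => frobSq X) μ := by
    simpa using integrable_frobSq_mul hsm (1 : Matrix (Fin N) (Fin N) ℂ)
  have hint2 : Integrable (fun X : Matrix (Fin N) (Fin T) ℂ => frobSq (X - U * Uᴴ * X)) μ := by
    simp_rw [hfrob]
    exact integrable_frobSq_mul hsm _
  rw [waterFillingLaw_eq_coloredGaussian, mutualInfo_add_klDiv_coloredGaussian μ hs hB hk hK hsm]
  have hint3 : ∀ j t, Integrable (fun X : Matrix (Fin N) (Fin T) ℂ => ‖(B * H * X) j t‖ ^ 2) μ :=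
    fun j t => (memLp_mul_entry hsm (B * H) j t).integrable_norm_pow (by norm_num)
  have hweight : ∑ j, ∑ t : Fin T, (∫ X, ‖(B * H * X) j t‖ ^ 2 ∂μ) / k j ≤
      η⁻¹ * (T * P) - η⁻¹ * ∫ X, frobSq (X - U * Uᴴ * X) ∂μ := by
    have e : ∑ j, ∑ t : Fin T, (∫ X, ‖(B * H * X) j t‖ ^ 2 ∂μ) / k j =
        ∫ X, ∑ j, ∑ t, (k j)⁻¹ * ‖(B * H * X) j t‖ ^ 2 ∂μ := by
      rw [integral_finsetSum _ fun j _ => integrable_finsetSum _ fun t _ => (hint3 j t).const_mul _]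
      refine Finset.sum_congr rfl fun j _ => ?_
      rw [integral_finsetSum _ fun t _ => (hint3 j t).const_mul _]
      refine Finset.sum_congr rfl fun t _ => ?_
      rw [integral_const_mul, inv_mul_eq_div]
    calc _ = ∫ X, ∑ j, ∑ t, (k j)⁻¹ * ‖(B * H * X) j t‖ ^ 2 ∂μ := e
      _ ≤ ∫ X, η⁻¹ * (frobSq X - frobSq (X - U * Uᴴ * X)) ∂μ := by
        refine integral_mono (integrable_finsetSum _ fun j _ => integrable_finsetSum _ fun t _ =>
          (hint3 j t).const_mul _) ((hint1.sub hint2).const_mul _) fun X => ?_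
        simp only
        rw [h.sum_weighted hs hB hk hK, frobSq_projection h.left X, add_sub_cancel_right, frobSq,
          Finset.mul_sum]
        refine Finset.sum_le_sum fun i _ => ?_
        rw [Finset.mul_sum]
        exact Finset.sum_le_sum fun t _ =>
          mul_le_mul_of_nonneg_right (weight_le hs hη0 (h.pos i)) (sq_nonneg _)
      _ = η⁻¹ * ∫ X, frobSq X ∂μ - η⁻¹ * ∫ X, frobSq (X - U * Uᴴ * X) ∂μ := by
        rw [integral_const_mul, integral_sub hint1 hint2, mul_sub]
      _ ≤ _ := by
        have := mul_le_mul_of_nonneg_left (hμ.integral_frobSq_le hT) (inv_pos.2 hη0).le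
        linarith
  have hsum : ∑ j, ∑ t : Fin T, (Real.log (k j / s) - 1 + s / k j +
      (∫ X, ‖(B * H * X) j t‖ ^ 2 ∂μ) / k j) =
      T * waterFillingRate γ s η - η⁻¹ * (T * P) +
        ∑ j, ∑ t : Fin T, (∫ X, ‖(B * H * X) j t‖ ^ 2 ∂μ) / k j := by
    have e1 : ∑ j, (Real.log (k j / s) - (1 - s / k j)) = waterFillingRate γ s η - η⁻¹ * P := by
      rw [Finset.sum_sub_distrib, sum_log_eq_logDetRate hs hB hk hK,
        h.sum_one_sub_div hs hP hη hB hk hK, h.logDetRate_waterFillingRoot hs hη0]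
    simp_rw [Finset.sum_add_distrib]
    congr 1
    have e2 : T * waterFillingRate γ s η - η⁻¹ * (T * P) =
      T * (waterFillingRate γ s η - η⁻¹ * P) := by ring
    rw [e2, ← e1, Finset.mul_sum, ← Finset.sum_add_distrib]
    refine Finset.sum_congr rfl fun j _ => ?_
    simp
    ring
  -- `ENNReal.ofReal` truncates at zero, so it is additive only on nonnegative terms; positivity
  -- comes from log x ≤ x − 1 at x = s/k.
  have hnonneg : 0 ≤ ∑ j, ∑ t : Fin T, (Real.log (k j / s) - 1 + s / k j +
      (∫ X, ‖(B * H * X) j t‖ ^ 2 ∂μ) / k j) := by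
    refine Finset.sum_nonneg fun j _ => Finset.sum_nonneg fun t _ => ?_
    have h1 : Real.log (s / k j) ≤ s / k j - 1 := Real.log_le_sub_one_of_pos (div_pos hs (hk j))
    have h2 : Real.log (k j / s) = -Real.log (s / k j) := by rw [← Real.log_inv, inv_div]
    have h3 : 0 ≤ (∫ X, ‖(B * H * X) j t‖ ^ 2 ∂μ) / k j :=
      div_nonneg (integral_nonneg fun _ => sq_nonneg _) (hk j).le
    linarith
  have hnn : 0 ≤ η⁻¹ * ∫ X, frobSq (X - U * Uᴴ * X) ∂μ :=
    mul_nonneg (inv_pos.2 hη0).le (integral_nonneg fun _ => frobSq_nonneg _)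
  rw [← ENNReal.ofReal_add hnonneg hnn]
  refine ENNReal.ofReal_le_ofReal ?_
  rw [hsum]
  linarith

end waterFilling

end MIMO

/-! ### Optimality and uniqueness of the water-filling law. -/

namespace MIMO

section waterFilling

variable {Nc N T : ℕ} {H : Matrix (Fin Nc) (Fin N) ℂ} {U V : Matrix (Fin N) (Fin H.rank) ℂ}
  {γ : Fin H.rank → ℝ} {s P η : ℝ}

lemma IsEigenmodeDecomposition.hasIIDGaussianColumns (h : IsEigenmodeDecomposition H U V γ) :
    HasIIDGaussianColumns (waterFillingLaw T V γ s η) (waterFillingCovariance U V γ s η) := by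
  rw [h.waterFillingCovariance_eq, waterFillingLaw_eq_coloredGaussian]
  exact hasIIDGaussianColumns_coloredGaussian T _

lemma IsEigenmodeDecomposition.trace_waterFillingCovariance
    (h : IsEigenmodeDecomposition H U V γ) (hη : IsWaterLevel γ s P η) :
    (waterFillingCovariance U V γ s η).trace = (P : ℂ) := by
  rw [waterFillingCovariance, Matrix.mul_assoc, Matrix.trace_mul_comm, Matrix.mul_assoc,
    ← h.left_eq_right, h.left, Matrix.mul_one, Matrix.trace_diagonal, ← hη, Complex.ofReal_sum]

lemma IsEigenmodeDecomposition.isAdmissible (h : IsEigenmodeDecomposition H U V γ) (hT : 0 < T)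
    (hη : IsWaterLevel γ s P η) : IsAdmissible P (waterFillingLaw T V γ s η) := by
  have hc := h.hasIIDGaussianColumns (T := T) (s := s) (η := η)
  refine ⟨hc.probability, hc.memLp, ?_⟩
  rw [hc.correlationMatrix hT, h.trace_waterFillingCovariance hη, Complex.ofReal_re]

lemma IsEigenmodeDecomposition.mutualInfo_waterFillingLaw (h : IsEigenmodeDecomposition H U V γ)
    (hs : 0 < s) (hη : 0 < η) : mutualInfo (channelJoint H s (waterFillingLaw T V γ s η)) =
      ENNReal.ofReal (T * waterFillingRate γ s η) := by
  rw [waterFillingLaw_eq_coloredGaussian, mutualInfo_coloredGaussian T H hs,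
    h.logDetRate_waterFillingRoot hs hη]

lemma IsEigenmodeDecomposition.coherentRate_waterFillingLaw
    (h : IsEigenmodeDecomposition H U V γ) (hT : 0 < T) (hs : 0 < s) (hη : 0 < η) :
    coherentRate H s (waterFillingLaw T V γ s η) = ENNReal.ofReal (waterFillingRate γ s η) := by
  rw [waterFillingLaw_eq_coloredGaussian, coherentRate_coloredGaussian hT H hs,
    h.logDetRate_waterFillingRoot hs hη]

lemma IsEigenmodeDecomposition.mutualInfo_le (h : IsEigenmodeDecomposition H U V γ)
    (hs : 0 < s) (hP : 0 < P) (hT : 0 < T) (hη : IsWaterLevel γ s P η)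
    {μ : Measure (Matrix (Fin N) (Fin T) ℂ)} (hμ : IsAdmissible P μ) :
    mutualInfo (channelJoint H s μ) ≤
      mutualInfo (channelJoint H s (waterFillingLaw T V γ s η)) := by
  obtain ⟨B, -, hle⟩ := h.mutualInfo_add_le hs hP hT hη
  rw [h.mutualInfo_waterFillingLaw hs (hη.pos h.pos hs hP)]
  exact (le_self_add.trans le_self_add).trans (hle μ hμ)

/-- A law that attains the maximal mutual information is the water-filling law. -/
lemma IsEigenmodeDecomposition.eq_waterFillingLaw (h : IsEigenmodeDecomposition H U V γ)
    (hs : 0 < s) (hP : 0 < P) (hT : 0 < T) (hη : IsWaterLevel γ s P η)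
    {μ : Measure (Matrix (Fin N) (Fin T) ℂ)} (hμ : IsAdmissible P μ)
    (hmax : mutualInfo (channelJoint H s (waterFillingLaw T V γ s η)) ≤
      mutualInfo (channelJoint H s μ)) : μ = waterFillingLaw T V γ s η := by
  have hη0 := hη.pos h.pos hs hP
  obtain ⟨B, hB, hle⟩ := h.mutualInfo_add_le hs hP hT hη
  have := hμ.probability
  have : IsProbabilityMeasure (waterFillingLaw T V γ s η) := (h.isAdmissible hT hη).probability
  have hle := hle μ hμ
  rw [h.mutualInfo_waterFillingLaw hs hη0] at hmax
  have hI := ((le_self_add.trans le_self_add).trans hle).antisymm hmax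
  rw [hI, add_assoc] at hle
  -- The mutual information equals the bound and is finite, so it cancels and the two slack terms
  -- must be zero.
  have hzero := nonpos_iff_eq_zero.1 ((ENNReal.add_le_add_iff_left ENNReal.ofReal_ne_top).1
    (hle.trans_eq (add_zero _).symm))
  obtain ⟨hkl, hproj⟩ := add_eq_zero.1 hzero
  rw [klDiv_eq_zero_iff] at hkl
  have hmap := map_mul_eq_of_snd_eq (B * H) μ hs.le _ hkl
  have hint : Integrable (fun X : Matrix (Fin N) (Fin T) ℂ => frobSq (X - U * Uᴴ * X)) μ := by
    have : ∀ X : Matrix (Fin N) (Fin T) ℂ, X - U * Uᴴ * X = (1 - U * Uᴴ) * X := fun X => by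
      rw [Matrix.sub_mul, Matrix.one_mul]
    simp_rw [this]
    exact integrable_frobSq_mul hμ.secondMoment _
  have hae : ∀ᵐ X ∂μ, X = U * Uᴴ * X := by
    have h0 : ∫ X, frobSq (X - U * Uᴴ * X) ∂μ = 0 := by
      refine le_antisymm ?_ (integral_nonneg fun _ => frobSq_nonneg _)
      rw [ENNReal.ofReal_eq_zero] at hproj
      exact nonpos_of_mul_nonpos_right hproj (inv_pos.2 hη0)
    rw [integral_eq_zero_iff_of_nonneg (fun _ => frobSq_nonneg _) hint] at h0
    filter_upwards [h0] with X hX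
    exact sub_eq_zero.1 (frobSq_eq_zero hX)
  -- A left inverse of `B * H` on the range of U, namely UΓ⁻¹U†H†B†; it recovers UU†X from the
  -- noiseless output.
  set L : Matrix (Fin N) (Fin Nc) ℂ :=
    U * Matrix.diagonal (fun i => (((γ i)⁻¹ : ℝ) : ℂ)) * Uᴴ * Hᴴ * Bᴴ with hL
  have hLB : L * (B * H) = U * Uᴴ := by
    have hinv : Matrix.diagonal (fun i => (((γ i)⁻¹ : ℝ) : ℂ)) *
        Matrix.diagonal (fun i => (γ i : ℂ)) = 1 := by
      rw [diagonal_ofReal_mul]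
      simp [inv_mul_cancel₀ (h.pos _).ne']
    calc L * (B * H) = U * Matrix.diagonal (fun i => (((γ i)⁻¹ : ℝ) : ℂ)) * Uᴴ * Hᴴ * (Bᴴ * B) * H := by
          simp only [hL, Matrix.mul_assoc]
      _ = U * Matrix.diagonal (fun i => (((γ i)⁻¹ : ℝ) : ℂ)) * Uᴴ * (Hᴴ * H) := by
          rw [mul_eq_one_comm.1 hB, Matrix.mul_one, Matrix.mul_assoc]
      _ = U * Matrix.diagonal (fun i => (((γ i)⁻¹ : ℝ) : ℂ)) * (Uᴴ * U) *
            Matrix.diagonal (fun i => (γ i : ℂ)) * Uᴴ := by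
          rw [h.gram]
          simp only [Matrix.mul_assoc]
      _ = U * Uᴴ := by
          rw [h.left, Matrix.mul_one, Matrix.mul_assoc U, hinv, Matrix.mul_one]
  have hrec : ∀ ν : Measure (Matrix (Fin N) (Fin T) ℂ),
      (ν.map (B * H * ·)).map (L * ·) = ν.map (U * Uᴴ * ·) := by
    intro ν
    rw [Measure.map_map (measurable_mul_left _) (measurable_mul_left _)]
    congr 1
    ext1 X
    simp only [Function.comp]
    rw [← Matrix.mul_assoc, hLB]
  calc μ = μ.map (U * Uᴴ * ·) := by
        conv_lhs => rw [← Measure.map_id (μ := μ)]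
        exact Measure.map_congr hae
    _ = (waterFillingLaw T V γ s η).map (U * Uᴴ * ·) := by rw [← hrec, hmap, hrec]
    _ = waterFillingLaw T V γ s η := by
        rw [waterFillingLaw_eq_coloredGaussian, map_coloredGaussian,
          h.projection_mul_waterFillingRoot]

lemma coherentRate_le_coherentRate_iff (hT : 0 < T) {μ ν : Measure (Matrix (Fin N) (Fin T) ℂ)} :
    coherentRate H s μ ≤ coherentRate H s ν ↔
      mutualInfo (channelJoint H s μ) ≤ mutualInfo (channelJoint H s ν) :=
  ENNReal.mul_le_mul_iff_right (by simp) (by simpa using hT.ne')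

lemma IsEigenmodeDecomposition.isRateMaximizer_iff (h : IsEigenmodeDecomposition H U V γ)
    (hs : 0 < s) (hP : 0 < P) (hT : 0 < T) (hη : IsWaterLevel γ s P η)
    (μ : Measure (Matrix (Fin N) (Fin T) ℂ)) :
    IsRateMaximizer H s P μ ↔ μ = waterFillingLaw T V γ s η := by
  constructor
  · rintro ⟨hμ, hmax⟩
    exact h.eq_waterFillingLaw hs hP hT hη hμ
      ((coherentRate_le_coherentRate_iff hT).1 (hmax _ (h.isAdmissible hT hη)))
  · rintro rfl
    exact ⟨h.isAdmissible hT hη, fun ν hν =>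
      (coherentRate_le_coherentRate_iff hT).2 (h.mutualInfo_le hs hP hT hη hν)⟩

lemma IsEigenmodeDecomposition.isRateMaximizer_iff_hasIIDGaussianColumns
    (h : IsEigenmodeDecomposition H U V γ) (hs : 0 < s) (hP : 0 < P) (hT : 0 < T)
    (hη : IsWaterLevel γ s P η) (μ : Measure (Matrix (Fin N) (Fin T) ℂ)) :
    IsRateMaximizer H s P μ ↔ HasIIDGaussianColumns μ (waterFillingCovariance U V γ s η) := by
  rw [h.isRateMaximizer_iff hs hP hT hη]
  constructor
  · rintro rfl
    exact h.hasIIDGaussianColumns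
  · intro hμ
    exact hμ.ext h.hasIIDGaussianColumns

end waterFilling

end MIMO

/-! ### Measurable selection of the optimal input and the ergodic rate. -/

namespace MIMO

open scoped ComplexOrder Topology

/-! ### Measurability of the optimal input -/

/-- A selection of strict maximizers over a compact set is continuous. -/
lemma continuousAt_of_strict_max {X Y : Type*} [TopologicalSpace X] [TopologicalSpace Y] {K : Set Y}
    (hK : IsCompact K) {f : X → Y → ℝ} (hf : Continuous (Function.uncurry f)) {S : X → Y} {x₀ : X}
    (hS : ∀ᶠ x in 𝓝 x₀, S x ∈ K) (hmax : ∀ᶠ x in 𝓝 x₀, ∀ y ∈ K, f x y ≤ f x (S x))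
    (hstrict : ∀ y ∈ K, y ≠ S x₀ → f x₀ y < f x₀ (S x₀)) : ContinuousAt S x₀ := by
  have hS₀ := hS.self_of_nhds
  intro O hO
  obtain ⟨O', hO'O, hO', hmem⟩ := mem_nhds_iff.1 hO
  -- By compactness the strict inequality outside `O'` survives small changes of x. A maximizer `S
  -- x` outside `O'` would then be beaten by the fixed competitor `S x₀`.
  have htube : ∀ᶠ x in 𝓝 x₀, ∀ y ∈ K \ O', f x y < f x (S x₀) := by
    refine (hK.diff hO').eventually_forall_of_forall_eventually fun y hy => ?_
    have hc : Continuous fun z : X × Y => f z.1 (S x₀) :=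
      hf.comp (continuous_fst.prodMk continuous_const)
    refine (isOpen_lt hf hc).mem_nhds (?_ : f x₀ y < f x₀ (S x₀))
    exact hstrict y hy.1 fun h => hy.2 (h ▸ hmem)
  change ∀ᶠ x in 𝓝 x₀, S x ∈ O
  filter_upwards [hS, hmax, htube] with x h1 h2 h3
  refine hO'O (by_contra fun h => ?_)
  exact absurd (h3 (S x) ⟨h1, h⟩) (not_lt.2 (h2 _ hS₀))

/-- The positive semidefinite matrices of squared Frobenius norm at most `P`. -/
def posSemidefBall (N : ℕ) (P : ℝ) : Set (Matrix (Fin N) (Fin N) ℂ) :=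
  {A | A.PosSemidef ∧ frobSq A ≤ P}

lemma continuous_frobSq {m n : ℕ} : Continuous (frobSq : Matrix (Fin m) (Fin n) ℂ → ℝ) := by
  unfold frobSq
  fun_prop

lemma isCompact_posSemidefBall (N : ℕ) (P : ℝ) : IsCompact (posSemidefBall N P) := by
  have hbox : IsCompact (Set.univ.pi fun _ : Fin N => Set.univ.pi fun _ : Fin N =>
      Metric.closedBall (0 : ℂ) (√P)) :=
    isCompact_univ_pi fun _ => isCompact_univ_pi fun _ => isCompact_closedBall _ _
  have hclosed : IsClosed (posSemidefBall N P) := by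
    have : posSemidefBall N P = {A | Aᴴ = A} ∩ ((⋂ x : Fin N → ℂ, {A | 0 ≤ star x ⬝ᵥ (A *ᵥ x)}) ∩
        {A | frobSq A ≤ P}) := by
      ext A
      simp only [posSemidefBall, Matrix.posSemidef_iff_dotProduct_mulVec, Matrix.IsHermitian,
        Set.mem_ofPred_eq, Set.mem_inter_iff, Set.mem_iInter, and_assoc]
    rw [this]
    refine (isClosed_eq (by fun_prop) (by fun_prop)).inter
      ((isClosed_iInter fun x => isClosed_le (by fun_prop) (by fun_prop)).inter
        (isClosed_le continuous_frobSq continuous_const))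
  refine hbox.of_isClosed_subset hclosed fun A hA => ?_
  simp only [Set.mem_pi, Set.mem_univ, forall_const, mem_closedBall_zero_iff]
  intro i t
  refine Real.le_sqrt_of_sq_le (le_trans ?_ hA.2)
  calc ‖A i t‖ ^ 2 ≤ ∑ t, ‖A i t‖ ^ 2 := Finset.single_le_sum (f := fun t => ‖A i t‖ ^ 2)
        (fun _ _ => sq_nonneg _) (Finset.mem_univ t)
    _ ≤ frobSq A := Finset.single_le_sum (f := fun i => ∑ t, ‖A i t‖ ^ 2)
        (fun _ _ => Finset.sum_nonneg fun _ _ => sq_nonneg _) (Finset.mem_univ i)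

/-- The matrix 1 + s⁻¹HAA†H† is positive definite, so the logarithm stays away from its singularity.
-/
lemma continuous_logDetRate {Nc N M : ℕ} {s : ℝ} (hs : 0 < s) :
    Continuous (Function.uncurry fun (H : Matrix (Fin Nc) (Fin N) ℂ)
      (A : Matrix (Fin N) (Fin M) ℂ) => logDetRate s H A) := by
  unfold logDetRate Function.uncurry
  refine Continuous.log (by fun_prop) fun p => ?_
  have h : (1 + (s : ℂ)⁻¹ • (p.1 * p.2 * (p.1 * p.2)ᴴ)).PosDef :=
    Matrix.PosDef.one.add_posSemidef
      ((Matrix.posSemidef_self_mul_conjTranspose _).smul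
        (by rw [← Complex.ofReal_inv]; exact_mod_cast (inv_pos.2 hs).le))
  exact (Complex.pos_iff.1 h.det_pos).1.ne'

/-- The trace of the correlation matrix is tr AA† = ‖A‖², which is why the compact set of candidate
roots is a Frobenius ball. -/
lemma coloredGaussian_isAdmissible {N T M : ℕ} (hT : 0 < T) {P : ℝ} {A : Matrix (Fin N) (Fin M) ℂ}
    (hA : frobSq A ≤ P) : IsAdmissible P (coloredGaussian T A) := by
  have hc := hasIIDGaussianColumns_coloredGaussian T A
  refine ⟨hc.probability, hc.memLp, ?_⟩
  rwa [hc.correlationMatrix hT, Matrix.trace_mul_comm, trace_conjTranspose_mul_self_eq_frobSq,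
    Complex.ofReal_re]

/-- The positive semidefinite square root `V P^{1/2} V†` of the water-filling covariance. -/
noncomputable def waterFillingSqrt {N r : ℕ} (V : Matrix (Fin N) (Fin r) ℂ) (γ : Fin r → ℝ) (s η : ℝ) :
    Matrix (Fin N) (Fin N) ℂ :=
  waterFillingRoot V γ s η * Vᴴ

section selection

variable {Nc N T : ℕ} {H : Matrix (Fin Nc) (Fin N) ℂ} {U V : Matrix (Fin N) (Fin H.rank) ℂ}
  {γ : Fin H.rank → ℝ} {s P η : ℝ}

lemma posSemidef_waterFillingSqrt {N r : ℕ} (V : Matrix (Fin N) (Fin r) ℂ) (γ : Fin r → ℝ)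
    (s η : ℝ) : (waterFillingSqrt V γ s η).PosSemidef :=
  Matrix.PosSemidef.mul_mul_conjTranspose_same (Matrix.PosSemidef.diagonal fun i => by simp) V

lemma IsEigenmodeDecomposition.waterFillingSqrt_mul_conjTranspose
    (h : IsEigenmodeDecomposition H U V γ) :
    waterFillingSqrt V γ s η * (waterFillingSqrt V γ s η)ᴴ =
      waterFillingRoot V γ s η * (waterFillingRoot V γ s η)ᴴ := by
  rw [waterFillingSqrt, Matrix.conjTranspose_mul, Matrix.conjTranspose_conjTranspose,
    Matrix.mul_assoc, ← Matrix.mul_assoc Vᴴ, h.right, Matrix.one_mul]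

/-- The factor VP^{1/2} has a size depending on rank H and a basis that is not canonical; the
positive semidefinite root gives the same law and lives in a fixed space, so continuity in H makes
sense. -/
lemma IsEigenmodeDecomposition.coloredGaussian_waterFillingSqrt
    (h : IsEigenmodeDecomposition H U V γ) :
    coloredGaussian T (waterFillingSqrt V γ s η) = waterFillingLaw T V γ s η :=
  coloredGaussian_congr h.waterFillingSqrt_mul_conjTranspose

lemma IsEigenmodeDecomposition.waterFillingSqrt_mem (h : IsEigenmodeDecomposition H U V γ)
    (hη : IsWaterLevel γ s P η) : waterFillingSqrt V γ s η ∈ posSemidefBall N P := by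
  refine ⟨posSemidef_waterFillingSqrt V γ s η, le_of_eq ?_⟩
  have h1 := trace_conjTranspose_mul_self_eq_frobSq (waterFillingSqrt V γ s η)
  rw [Matrix.trace_mul_comm, h.waterFillingSqrt_mul_conjTranspose, ← h.waterFillingCovariance_eq,
    h.trace_waterFillingCovariance hη] at h1
  exact_mod_cast h1.symm

lemma IsEigenmodeDecomposition.logDetRate_waterFillingSqrt (h : IsEigenmodeDecomposition H U V γ)
    (hs : 0 < s) (hη : 0 < η) :
    logDetRate s H (waterFillingSqrt V γ s η) = waterFillingRate γ s η := by
  rw [← h.logDetRate_waterFillingRoot hs hη, logDetRate, logDetRate,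
    Matrix.conjTranspose_mul, Matrix.conjTranspose_mul]
  have : ∀ {M : ℕ} (A : Matrix (Fin N) (Fin M) ℂ), H * A * (Aᴴ * Hᴴ) = H * (A * Aᴴ) * Hᴴ := by
    intro M A
    simp only [Matrix.mul_assoc]
  rw [this, this, h.waterFillingSqrt_mul_conjTranspose]

lemma waterFillingRate_nonneg {r : ℕ} (γ : Fin r → ℝ) (s η : ℝ) : 0 ≤ waterFillingRate γ s η :=
  Finset.sum_nonneg fun _ _ => le_max_right _ _

/-- Strictness comes from uniqueness of the optimal law. A tie would make `coloredGaussian 1 A` that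
law, so the covariances, and hence the positive semidefinite roots, would coincide. The log-det rate
does not involve the block length, so length 1 suffices. -/
lemma IsEigenmodeDecomposition.logDetRate_lt (h : IsEigenmodeDecomposition H U V γ) (hs : 0 < s)
    (hP : 0 < P) (hη : IsWaterLevel γ s P η) {A : Matrix (Fin N) (Fin N) ℂ}
    (hA : A ∈ posSemidefBall N P) (hne : A ≠ waterFillingSqrt V γ s η) :
    logDetRate s H A < logDetRate s H (waterFillingSqrt V γ s η) := by
  have hη0 := hη.pos h.pos hs hP
  rw [h.logDetRate_waterFillingSqrt hs hη0]
  have hadm := coloredGaussian_isAdmissible (T := 1) one_pos hA.2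
  have hle := h.mutualInfo_le hs hP one_pos hη hadm
  by_contra! hge
  apply hne
  have heq := h.eq_waterFillingLaw hs hP one_pos hη hadm (by
    rw [h.mutualInfo_waterFillingLaw hs hη0, mutualInfo_coloredGaussian 1 H hs]
    exact ENNReal.ofReal_le_ofReal (by simpa using hge))
  have hcov : A * Aᴴ = waterFillingSqrt V γ s η * (waterFillingSqrt V γ s η)ᴴ := by
    rw [← (hasIIDGaussianColumns_coloredGaussian 1 A).correlationMatrix one_pos, heq,
      ← h.coloredGaussian_waterFillingSqrt,
      (hasIIDGaussianColumns_coloredGaussian 1 _).correlationMatrix one_pos]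
  have hS := posSemidef_waterFillingSqrt V γ s η
  rw [hA.1.isHermitian.eq, hS.isHermitian.eq] at hcov
  exact posSemidef_eq_of_mul_self_eq hA.1 hS hcov

/-- From log(1 + x) ≤ x, pᵢ ≤ P and Σγᵢ = ‖H‖². Since ‖H‖² is integrable, this makes the ergodic
rate finite. -/
lemma IsEigenmodeDecomposition.waterFillingRate_le (h : IsEigenmodeDecomposition H U V γ)
    (hs : 0 < s) (hP : 0 < P) (hη : IsWaterLevel γ s P η) :
    waterFillingRate γ s η ≤ s⁻¹ * P * frobSq H := by
  have hη0 := hη.pos h.pos hs hP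
  have htr : ∑ i, γ i = frobSq H := by
    have h1 := trace_conjTranspose_mul_self_eq_frobSq H
    rw [h.gram, Matrix.trace_mul_comm, ← Matrix.mul_assoc, h.left, Matrix.one_mul,
      Matrix.trace_diagonal] at h1
    exact_mod_cast h1
  rw [← htr, Finset.mul_sum]
  refine Finset.sum_le_sum fun i _ => ?_
  have hp : waterPower s η (γ i) ≤ P := hη ▸ Finset.single_le_sum
    (f := fun i => waterPower s η (γ i)) (fun _ _ => waterPower_nonneg _ _ _) (Finset.mem_univ i)
  have hγ := h.pos i
  rw [← one_add_waterPower hs hη0 hγ]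
  have hnn := mul_nonneg hγ.le (waterPower_nonneg s η (γ i))
  calc _ ≤ 1 + s⁻¹ * (γ i * waterPower s η (γ i)) - 1 :=
        Real.log_le_sub_one_of_pos (by positivity)
    _ = s⁻¹ * waterPower s η (γ i) * γ i := by ring
    _ ≤ _ := by gcongr

end selection

/-! ### The ergodic rate -/

/-- For H = 0 the output is pure noise. This realization has to be treated apart because no
decomposition is assumed there. -/
lemma coherentRate_zero {Nc N T : ℕ} (s : ℝ) (μ : Measure (Matrix (Fin N) (Fin T) ℂ))
    [IsProbabilityMeasure μ] : coherentRate (0 : Matrix (Fin Nc) (Fin N) ℂ) s μ = 0 := by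
  have h : channelJoint (0 : Matrix (Fin Nc) (Fin N) ℂ) s μ = μ.prod (gaussianMatrix Nc T s) := by
    rw [channelJoint]
    simp
  rw [coherentRate, mutualInfo, h, Measure.fst_prod, Measure.snd_prod, klDiv_self, mul_zero]

lemma integrable_frobSq_gaussianMatrix (m n : ℕ) (v : ℝ) :
    Integrable (frobSq : Matrix (Fin m) (Fin n) ℂ → ℝ) (gaussianMatrix m n v) :=
  integrable_finsetSum _ fun j _ => integrable_finsetSum _ fun t _ =>
    (memLp_entry_gaussianMatrix v j t).integrable_norm_pow (by norm_num)

lemma measurable_coloredGaussian {α : Type*} [MeasurableSpace α] {N M : ℕ} (T : ℕ)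
    {S : α → Matrix (Fin N) (Fin M) ℂ} (hS : Measurable S) :
    Measurable fun a => coloredGaussian T (S a) := by
  refine Measure.measurable_of_measurable_coe _ fun s hs => ?_
  have hm : Measurable fun p : α × Matrix (Fin M) (Fin T) ℂ => S p.1 * p.2 := by
    have hc : Continuous fun q : Matrix (Fin N) (Fin M) ℂ × Matrix (Fin M) (Fin T) ℂ =>
      q.1 * q.2 := by fun_prop
    exact hc.measurable.comp ((hS.comp measurable_fst).prodMk measurable_snd)
  have := measurable_measure_prodMk_left (ν := gaussianMatrix M T 1) (hm hs)
  convert this using 2 with a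
  rw [coloredGaussian, Measure.map_apply (measurable_mul_left _) hs]
  rfl

section ergodic

variable {Nc N T : ℕ} {h s P : ℝ}
  {U V : ∀ H : Matrix (Fin Nc) (Fin N) ℂ, Matrix (Fin N) (Fin H.rank) ℂ}
  {γ : ∀ H : Matrix (Fin Nc) (Fin N) ℂ, Fin H.rank → ℝ} {η : Matrix (Fin Nc) (Fin N) ℂ → ℝ}

open scoped Classical in
/-- The square root of the water-filling covariance, as a function of the channel matrix. -/
noncomputable def optimalRoot (s : ℝ) (V : ∀ H : Matrix (Fin Nc) (Fin N) ℂ, Matrix (Fin N) (Fin H.rank) ℂ)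
    (γ : ∀ H : Matrix (Fin Nc) (Fin N) ℂ, Fin H.rank → ℝ) (η : Matrix (Fin Nc) (Fin N) ℂ → ℝ)
    (H : Matrix (Fin Nc) (Fin N) ℂ) : Matrix (Fin N) (Fin N) ℂ :=
  if H = 0 then 0 else waterFillingSqrt (V H) (γ H) s (η H)

lemma optimalRoot_of_ne {H : Matrix (Fin Nc) (Fin N) ℂ} (hH : H ≠ 0) :
    optimalRoot s V γ η H = waterFillingSqrt (V H) (γ H) s (η H) := if_neg hH

/-- No measurability of U, V, γ, η in H is assumed. Being the strict maximizer of a continuous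
function over a compact set, the root is continuous on H ≠ 0, and its value at a single point does
not affect measurability. -/
lemma measurable_optimalRoot (hs : 0 < s) (hP : 0 < P)
    (hyp : ∀ H, H ≠ 0 → IsEigenmodeDecomposition H (U H) (V H) (γ H) ∧
      IsWaterLevel (γ H) s P (η H)) : Measurable (optimalRoot s V γ η) := by
  refine measurable_of_continuousOn_compl_singleton 0 fun H (hH : H ≠ 0) => ?_
  refine ContinuousAt.continuousWithinAt ?_
  have hne : ∀ᶠ H' in 𝓝 H, H' ≠ 0 := isOpen_ne.mem_nhds hH
  have hlt : ∀ H' : Matrix (Fin Nc) (Fin N) ℂ, H' ≠ 0 → ∀ A ∈ posSemidefBall N P,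
      A ≠ optimalRoot s V γ η H' →
      logDetRate s H' A < logDetRate s H' (optimalRoot s V γ η H') := by
    intro H' hH' A hA hA'
    rw [optimalRoot_of_ne hH'] at hA' ⊢
    exact (hyp H' hH').1.logDetRate_lt hs hP (hyp H' hH').2 hA hA'
  refine continuousAt_of_strict_max (isCompact_posSemidefBall N P) (continuous_logDetRate hs)
    ?_ ?_ (hlt H hH)
  · filter_upwards [hne] with H' hH'
    rw [optimalRoot_of_ne hH']
    exact (hyp H' hH').1.waterFillingSqrt_mem (hyp H' hH').2
  · filter_upwards [hne] with H' hH' A hA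
    rcases eq_or_ne A (optimalRoot s V γ η H') with rfl | hA'
    · exact le_rfl
    · exact (hlt H' hH' A hA hA').le

/-- Rewrites the rate, whose index type varies with H, as a continuous function of H and the
measurable root. At H = 0 the sum is empty and the determinant is 1. -/
lemma waterFillingRate_eq_logDetRate (hs : 0 < s) (hP : 0 < P)
    (hyp : ∀ H, H ≠ 0 → IsEigenmodeDecomposition H (U H) (V H) (γ H) ∧
      IsWaterLevel (γ H) s P (η H)) (H : Matrix (Fin Nc) (Fin N) ℂ) :
    waterFillingRate (γ H) s (η H) = logDetRate s H (optimalRoot s V γ η H) := by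
  rcases eq_or_ne H 0 with rfl | hH
  · have : IsEmpty (Fin (0 : Matrix (Fin Nc) (Fin N) ℂ).rank) := by
      rw [Matrix.rank_zero]
      infer_instance
    rw [waterFillingRate, Finset.univ_eq_empty, Finset.sum_empty, logDetRate]
    simp
  · obtain ⟨h1, h2⟩ := hyp H hH
    rw [optimalRoot_of_ne hH, h1.logDetRate_waterFillingSqrt hs (h2.pos h1.pos hs hP)]

lemma coherentRate_le_waterFillingRate (hT : 0 < T) (hs : 0 < s) (hP : 0 < P)
    (hyp : ∀ H, H ≠ 0 → IsEigenmodeDecomposition H (U H) (V H) (γ H) ∧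
      IsWaterLevel (γ H) s P (η H)) (H : Matrix (Fin Nc) (Fin N) ℂ)
    {μ : Measure (Matrix (Fin N) (Fin T) ℂ)} (hμ : IsAdmissible P μ) :
    coherentRate H s μ ≤ ENNReal.ofReal (waterFillingRate (γ H) s (η H)) := by
  rcases eq_or_ne H 0 with rfl | hH
  · have := hμ.probability
    rw [coherentRate_zero]
    exact zero_le
  · obtain ⟨h1, h2⟩ := hyp H hH
    rw [← h1.coherentRate_waterFillingLaw hT hs (h2.pos h1.pos hs hP)]
    exact (coherentRate_le_coherentRate_iff hT).2 (h1.mutualInfo_le hs hP hT h2 hμ)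

lemma measurable_uncurry_apply {α β δ : Type*} [MeasurableSpace α] [MeasurableSpace β]
    [MeasurableSpace δ] {f : α → β → δ} (hf : Measurable (Function.uncurry f)) {g : α → β}
    (hg : Measurable g) : Measurable fun a => f a (g a) :=
  hf.comp (measurable_id.prodMk hg)

lemma measurable_logDetRate {M : ℕ} (hs : 0 < s) :
    Measurable (Function.uncurry fun (H : Matrix (Fin Nc) (Fin N) ℂ)
      (A : Matrix (Fin N) (Fin M) ℂ) => logDetRate s H A) :=
  (continuous_logDetRate hs).measurable

lemma measurable_waterFillingRate (hs : 0 < s) (hP : 0 < P)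
    (hyp : ∀ H, H ≠ 0 → IsEigenmodeDecomposition H (U H) (V H) (γ H) ∧
      IsWaterLevel (γ H) s P (η H)) : Measurable fun H => waterFillingRate (γ H) s (η H) := by
  have e : (fun H => waterFillingRate (γ H) s (η H)) =
      fun H => logDetRate s H (optimalRoot s V γ η H) :=
    funext fun H => waterFillingRate_eq_logDetRate hs hP hyp H
  rw [e]
  exact measurable_uncurry_apply (measurable_logDetRate hs) (measurable_optimalRoot hs hP hyp)

lemma waterFillingRate_le_of_forall (hs : 0 < s) (hP : 0 < P)
    (hyp : ∀ H, H ≠ 0 → IsEigenmodeDecomposition H (U H) (V H) (γ H) ∧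
      IsWaterLevel (γ H) s P (η H)) (H : Matrix (Fin Nc) (Fin N) ℂ) :
    waterFillingRate (γ H) s (η H) ≤ s⁻¹ * P * frobSq H := by
  rcases eq_or_ne H 0 with rfl | hH
  · rw [waterFillingRate_eq_logDetRate hs hP hyp, logDetRate]
    have := mul_nonneg (mul_nonneg (inv_pos.2 hs).le hP.le)
      (frobSq_nonneg (0 : Matrix (Fin Nc) (Fin N) ℂ))
    simpa using this
  · exact (hyp H hH).1.waterFillingRate_le hs hP (hyp H hH).2

lemma integrable_waterFillingRate (hs : 0 < s) (hP : 0 < P)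
    (hyp : ∀ H, H ≠ 0 → IsEigenmodeDecomposition H (U H) (V H) (γ H) ∧
      IsWaterLevel (γ H) s P (η H)) :
    Integrable (fun H => waterFillingRate (γ H) s (η H)) (gaussianMatrix Nc N h) := by
  refine Integrable.mono' ((integrable_frobSq_gaussianMatrix Nc N h).const_mul (s⁻¹ * P))
    (measurable_waterFillingRate hs hP hyp).aestronglyMeasurable
    (Filter.Eventually.of_forall fun H => ?_)
  rw [Real.norm_of_nonneg (waterFillingRate_nonneg _ _ _)]
  exact waterFillingRate_le_of_forall hs hP hyp H

/-- The conditional law of the water-filling waveform given the channel matrix. -/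
noncomputable def optimalKernel (T : ℕ) {S : Matrix (Fin Nc) (Fin N) ℂ → Matrix (Fin N) (Fin N) ℂ}
    (hS : Measurable S) : Kernel (Matrix (Fin Nc) (Fin N) ℂ) (Matrix (Fin N) (Fin T) ℂ) :=
  ⟨fun H => coloredGaussian T (S H), measurable_coloredGaussian T hS⟩

/-- The bound for each realization integrates over any almost surely admissible kernel, and the
kernel built from the measurable root attains it for every H; at H = 0 both rates are zero. -/
lemma maxErgodicRate_spec (hT : 0 < T) (hs : 0 < s) (hP : 0 < P)
    (hyp : ∀ H, H ≠ 0 → IsEigenmodeDecomposition H (U H) (V H) (γ H) ∧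
      IsWaterLevel (γ H) s P (η H)) :
    maxErgodicRate Nc N T h s P =
      ENNReal.ofReal (∫ H, waterFillingRate (γ H) s (η H) ∂(gaussianMatrix Nc N h)) ∧
    ∃ κ : Kernel (Matrix (Fin Nc) (Fin N) ℂ) (Matrix (Fin N) (Fin T) ℂ),
      (∀ H, IsAdmissible P (κ H)) ∧
      (∀ H, H ≠ 0 → κ H = waterFillingLaw T (V H) (γ H) s (η H)) ∧
      ergodicRate h s κ = maxErgodicRate Nc N T h s P := by
  let κ := optimalKernel T (measurable_optimalRoot hs hP hyp)
  have hκ : ∀ H, κ H = coloredGaussian T (optimalRoot s V γ η H) := fun H => rfl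
  have hadm : ∀ H, IsAdmissible P (κ H) := by
    intro H
    rw [hκ]
    refine coloredGaussian_isAdmissible hT ?_
    rcases eq_or_ne H 0 with rfl | hH
    · rw [optimalRoot, if_pos rfl]
      simpa [frobSq] using hP.le
    · rw [optimalRoot_of_ne hH]
      exact ((hyp H hH).1.waterFillingSqrt_mem (hyp H hH).2).2
  have hlaw : ∀ H, H ≠ 0 → κ H = waterFillingLaw T (V H) (γ H) s (η H) := by
    intro H hH
    rw [hκ, optimalRoot_of_ne hH, (hyp H hH).1.coloredGaussian_waterFillingSqrt]
  have hint : ENNReal.ofReal (∫ H, waterFillingRate (γ H) s (η H) ∂(gaussianMatrix Nc N h)) =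
      ∫⁻ H, ENNReal.ofReal (waterFillingRate (γ H) s (η H)) ∂(gaussianMatrix Nc N h) :=
    ofReal_integral_eq_lintegral_ofReal (integrable_waterFillingRate hs hP hyp)
      (Filter.Eventually.of_forall fun H => waterFillingRate_nonneg _ _ _)
  have hrate : ergodicRate h s κ =
      ENNReal.ofReal (∫ H, waterFillingRate (γ H) s (η H) ∂(gaussianMatrix Nc N h)) := by
    rw [hint]
    refine lintegral_congr fun H => ?_
    rw [hκ, coherentRate_coloredGaussian hT H hs, waterFillingRate_eq_logDetRate hs hP hyp]
  have hmax : maxErgodicRate Nc N T h s P =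
      ENNReal.ofReal (∫ H, waterFillingRate (γ H) s (η H) ∂(gaussianMatrix Nc N h)) := by
    refine le_antisymm (iSup₂_le fun κ' hκ' => ?_) ?_
    · rw [hint]
      refine lintegral_mono_ae ?_
      filter_upwards [hκ'] with H hH
      exact coherentRate_le_waterFillingRate hT hs hP hyp H hH
    · rw [← hrate]
      exact le_iSup₂_of_le κ (Filter.Eventually.of_forall hadm) le_rfl
  exact ⟨hmax, κ, hadm, hlaw, hrate.trans hmax.symm⟩

end ergodic

end MIMO

/-! ### The theorem. -/

theorem theorem6 (N Nc T : ℕ) (hN : 0 < N) (hNc : 0 < Nc) (hT : 0 < T)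
    (P₀ σc σh : ℝ) (hP₀ : 0 < P₀) (hσc : 0 < σc) (hσh : 0 < σh) :
    -- the optimal waveform and its rate, for each channel realization
    (∀ H : Matrix (Fin Nc) (Fin N) ℂ, H ≠ 0 →
      (∃ U V γ, IsEigenmodeDecomposition H U V γ) ∧
      ∀ U V γ, IsEigenmodeDecomposition H U V γ →
        (∃! η : ℝ, IsWaterLevel γ (σc ^ 2) (N * P₀) η) ∧
        ∀ η : ℝ, IsWaterLevel γ (σc ^ 2) (N * P₀) η →
          (∀ μ : Measure (Matrix (Fin N) (Fin T) ℂ),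
            (IsRateMaximizer H (σc ^ 2) (N * P₀) μ ↔
              HasIIDGaussianColumns μ (waterFillingCovariance U V γ (σc ^ 2) η)) ∧
            (IsRateMaximizer H (σc ^ 2) (N * P₀) μ ↔
              μ = waterFillingLaw T V γ (σc ^ 2) η)) ∧
          correlationMatrix (waterFillingLaw T V γ (σc ^ 2) η) =
            waterFillingCovariance U V γ (σc ^ 2) η ∧
          (waterFillingCovariance U V γ (σc ^ 2) η).trace = ((N * P₀ : ℝ) : ℂ) ∧
          coherentRate H (σc ^ 2) (waterFillingLaw T V γ (σc ^ 2) η) =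
            ENNReal.ofReal (waterFillingRate γ (σc ^ 2) η)) ∧
    -- the maximal ergodic rate
    (∀ (U V : ∀ H : Matrix (Fin Nc) (Fin N) ℂ, Matrix (Fin N) (Fin H.rank) ℂ)
      (γ : ∀ H : Matrix (Fin Nc) (Fin N) ℂ, Fin H.rank → ℝ)
      (η : Matrix (Fin Nc) (Fin N) ℂ → ℝ),
      (∀ H, H ≠ 0 → IsEigenmodeDecomposition H (U H) (V H) (γ H) ∧
        IsWaterLevel (γ H) (σc ^ 2) (N * P₀) (η H)) →
      Integrable (fun H => waterFillingRate (γ H) (σc ^ 2) (η H)) (gaussianMatrix Nc N (σh ^ 2)) ∧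
      maxErgodicRate Nc N T (σh ^ 2) (σc ^ 2) (N * P₀) =
        ENNReal.ofReal
          (∫ H, waterFillingRate (γ H) (σc ^ 2) (η H) ∂(gaussianMatrix Nc N (σh ^ 2))) ∧
      ∃ κ : Kernel (Matrix (Fin Nc) (Fin N) ℂ) (Matrix (Fin N) (Fin T) ℂ),
        (∀ H, IsAdmissible (N * P₀) (κ H)) ∧
        (∀ H, H ≠ 0 → κ H = waterFillingLaw T (V H) (γ H) (σc ^ 2) (η H)) ∧
        ergodicRate (σh ^ 2) (σc ^ 2) κ = maxErgodicRate Nc N T (σh ^ 2) (σc ^ 2) (N * P₀)) := by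
  have hs : 0 < σc ^ 2 := by positivity
  have hP : 0 < (N : ℝ) * P₀ := by positivity
  refine ⟨fun H hH => ⟨exists_isEigenmodeDecomposition H, fun U V γ h =>
    ⟨existsUnique_isWaterLevel (h.rank_pos hH) h.pos hs hP, fun η hη =>
      ⟨fun μ => ⟨h.isRateMaximizer_iff_hasIIDGaussianColumns hs hP hT hη μ,
        h.isRateMaximizer_iff hs hP hT hη μ⟩,
      h.hasIIDGaussianColumns.correlationMatrix hT, h.trace_waterFillingCovariance hη,
      h.coherentRate_waterFillingLaw hT hs (hη.pos h.pos hs hP)⟩⟩⟩, fun U V γ η hyp =>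
    ⟨integrable_waterFillingRate hs hP hyp, maxErgodicRate_spec hT hs hP hyp⟩⟩
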